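/- Let $p>2$ be a prime and $d$ a natural number. For $u\in\mathbb{Q}_p$ let $\vartheta(u)$ be its $p$-adic valuation, $|u|_p$ its $p$-adic absolute value, and $\{u\}_p\in\mathbb{Q}$ its fractional part. Let $\mathbb{H}_d=\mathbb{H}_d(\mathbb{Z}_p)$ be the compact group $\mathbb{Z}_p^d\times\mathbb{Z}_p^d\times\mathbb{Z}_p$ with the product topology and $$(\mathbf{x},\mathbf{y},z)\star(\mathbf{x}',\mathbf{y}',z')=(\mathbf{x}+\mathbf{x}',\mathbf{y}+\mathbf{y}',z+z'+\mathbf{x}\cdot\mathbf{y}'),$$ and let $\mathbb{H}_d(p^n\mathbb{Z}_p)$ be the subgroup of the elements all of whose coordinates lie in $p^n\mathbb{Z}_p$. The groups $\mathbb{Z}_p^d$ and $\mathbb{H}_d$ carry their normalized Haar measures. For $n\ge 0$ the elements of $\mathbb{Q}_p/p^{-n}\mathbb{Z}_p$ are identified with the following representatives: the trivial class with $1$, every other class with its element of the form $\sum_{k\ge n+1}c_kp^{-k}$ (a finite sum, $c_k\in\{0,\dots,p-1\}$); for vectors this is done in each coordinate. Let $\widehat{\mathbb{H}}_d$ be the unitary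 dual, i.e. the set of unitary equivalence classes of irreducible (strongly continuous) unitary representations of $\mathbb{H}_d$ on complex Hilbert spaces. For $\lambda\in\mathbb{Q}_p/\mathbb{Z}_p$ (so that $|\lambda|_p\ge1$ for its representative) let $\mathcal{H}_\lambda\subset L^2(\mathbb{Z}_p^d)$ be the span of the functions $$\varphi_h=|\lambda|_p^{d/2}\,\mathbf{1}_{h+p^{-\vartheta(\lambda)}\mathbb{Z}_p^d},\qquad h\in\mathbb{Z}_p^d/p^{-\vartheta(\lambda)}\mathbb{Z}_p^d .$$ Then the $\varphi_h$ form an orthonormal basis of $\mathcal{H}_\lambda$, and $\dim\mathcal{H}_\lambda=|\lambda|_p^d$. For every triple $(\xi,\eta,\lambda)$ with $\lambda\in\mathbb{Q}_p/\mathbb{Z}_p$ and $(\xi,\eta)\in\mathbb{Q}_p^{2d}/p^{\vartheta(\lambda)}\mathbb{Z}_p^{2d}$, the formula $$\pi_{(\xi,\eta,\lambda)}(\mathbf{x},\mathbf{y},z)\varphi(u)=e^{2\pi i\{\xi\cdot\mathbf{x}+\eta\cdot\mathbf{y}+\lambda(z+u\cdot\mathbf{y})\}_p}\,\varphi(u+\mathbf{x})$$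 defines an irreducible unitary representation of $\mathbb{H}_d$ on $\mathcal{H}_\lambda$, and $(\xi,\eta,\lambda)\mapsto[\pi_{(\xi,\eta,\lambda)}]$ is a bijection from the set of these triples onto $\widehat{\mathbb{H}}_d$. The matrix coefficients $(\pi_{(\xi,\eta,\lambda)})_{hh'}=(\pi_{(\xi,\eta,\lambda)}\varphi_h,\varphi_{h'})_{L^2(\mathbb{Z}_p^d)}$ are $$(\pi_{(\xi,\eta,\lambda)})_{hh'}(\mathbf{x},\mathbf{y},z)=e^{2\pi i\{\xi\cdot\mathbf{x}+\eta\cdot\mathbf{y}+\lambda(z+h'\cdot\mathbf{y})\}_p}\,\mathbf{1}_{h-h'+p^{-\vartheta(\lambda)}\mathbb{Z}_p^d}(\mathbf{x}),$$ and the characters are $$\chi_{\pi_{(\xi,\eta,\lambda)}}(\mathbf{x},\mathbf{y},z)=|\lambda|_p^d\,e^{2\pi i\{\xi\cdot\mathbf{x}+\eta\cdot\mathbf{y}+\lambda z\}_p}\,\mathbf{1}_{p^{-\vartheta(\lambda)}\mathbb{Z}_p^d}(\mathbf{x})\,\mathbf{1}_{p^{-\vartheta(\lambda)}\mathbb{Z}_p^d}(\mathbf{y}).$$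 Finally, for every $n\ge0$ let $\mathcal{D}_n(\mathbb{H}_d)$ be the space of functions $f:\mathbb{H}_d\to\mathbb{C}$ with $f(g\star k)=f(g)$ for all $g\in\mathbb{H}_d$ and $k\in\mathbb{H}_d(p^n\mathbb{Z}_p)$. The functions $|\lambda|_p^{d/2}(\pi_{(\xi,\eta,\lambda)})_{hh'}$, with $(\xi,\eta,\lambda)$ as above, $\|(\xi,\eta,\lambda)\|_p\le p^n$ (the maximum of the $p$-adic absolute values of the coordinates) and $h,h'\in\mathbb{Z}_p^d/p^{-\vartheta(\lambda)}\mathbb{Z}_p^d$, form a basis of $\mathcal{D}_n(\mathbb{H}_d)$ that is orthonormal in $L^2(\mathbb{H}_d)$. -/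

import Mathlib

open MeasureTheory
open scoped ENNReal

/-! ### The standard additive character of `ℚ_p` -/

/-- `u * p ^ k` is a `p`-adic integer for `k = max (-ϑ(u)) 0`. -/
theorem padic_norm_mul_pow_le_one {p : ℕ} [Fact p.Prime] (u : ℚ_[p]) :
    ‖u * (p : ℚ_[p]) ^ (-u.valuation).toNat‖ ≤ 1 := by
  by_cases hu : u = 0
  · simp [hu]
  · have hp : (1 : ℝ) < p := by exact_mod_cast (Fact.out : p.Prime).one_lt
    have hp0 : (0 : ℝ) < p := by linarith
    rw [norm_mul, norm_pow, Padic.norm_p, Padic.norm_eq_zpow_neg_valuation hu, inv_pow,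
      ← zpow_natCast, ← zpow_neg, ← zpow_add₀ hp0.ne']
    apply zpow_le_one_of_nonpos₀ hp.le
    have := Int.self_le_toNat (-u.valuation)
    lia

/-- The fractional part `{u}_p ∈ ℚ`: with `k = max (-ϑ(u)) 0`, the natural number formed by
the first `k` digits of the `p`-adic integer `p ^ k u`, divided by `p ^ k`. -/
noncomputable def padicFract {p : ℕ} [Fact p.Prime] (u : ℚ_[p]) : ℚ :=
  (PadicInt.appr (⟨u * (p : ℚ_[p]) ^ (-u.valuation).toNat, padic_norm_mul_pow_le_one u⟩ : ℤ_[p])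
    (-u.valuation).toNat : ℚ) / (p : ℚ) ^ (-u.valuation).toNat

/-- The character `u ↦ e^{2 π i {u}_p}`. -/
noncomputable def padicExp {p : ℕ} [Fact p.Prime] (u : ℚ_[p]) : ℂ :=
  Complex.exp (2 * Real.pi * Complex.I * ((padicFract u : ℚ) : ℂ))

/-- The inclusion of `ℤ_p^d` in `ℚ_p^d`. -/
def vecQ {p d : ℕ} [Fact p.Prime] (v : Fin d → ℤ_[p]) : Fin d → ℚ_[p] := fun i => (v i : ℚ_[p])

/-! ### The subgroups `p^n ℤ_p^d` and the measure on `ℤ_p^d` -/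

/-- The subgroup `p^n ℤ_p^d` of `ℤ_p^d`. -/
noncomputable def padicBall (p d : ℕ) [Fact p.Prime] (n : ℕ) : AddSubgroup (Fin d → ℤ_[p]) where
  carrier := {u | ∀ i, (p : ℤ_[p]) ^ n ∣ u i}
  zero_mem' := fun _ => dvd_zero _
  add_mem' := fun ha hb i => dvd_add (ha i) (hb i)
  neg_mem' := fun ha i => (dvd_neg).2 (ha i)

theorem isOpen_dvd_padicInt (p : ℕ) [Fact p.Prime] (n : ℕ) :
    IsOpen {a : ℤ_[p] | (p : ℤ_[p]) ^ n ∣ a} := by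
  have : {a : ℤ_[p] | (p : ℤ_[p]) ^ n ∣ a} = Metric.closedBall 0 ((p : ℝ) ^ (-n : ℤ)) := by
    ext a
    rw [Metric.mem_closedBall, dist_zero_right, PadicInt.norm_le_pow_iff_mem_span_pow,
      Ideal.mem_span_singleton, Set.mem_ofPred_eq]
  rw [this]
  apply IsUltrametricDist.isOpen_closedBall
  have : 0 < p := (Fact.out : p.Prime).pos
  positivity

theorem isOpen_padicBall (p d : ℕ) [Fact p.Prime] (n : ℕ) :
    IsOpen (padicBall p d n : Set (Fin d → ℤ_[p])) := by
  have : (padicBall p d n : Set (Fin d → ℤ_[p])) =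
      ⋂ i, (fun u : Fin d → ℤ_[p] => u i) ⁻¹' {a : ℤ_[p] | (p : ℤ_[p]) ^ n ∣ a} := by
    ext u; simp [padicBall]
  rw [this]
  exact isOpen_iInter_of_finite fun i => (isOpen_dvd_padicInt p n).preimage (continuous_apply i)

/-- The finite index set `ℤ_p^d / p^n ℤ_p^d`. -/
abbrev PadicCosets (p d : ℕ) [Fact p.Prime] (n : ℕ) : Type :=
  (Fin d → ℤ_[p]) ⧸ padicBall p d n

instance instFinitePadicCosets (p d : ℕ) [Fact p.Prime] (n : ℕ) : Finite (PadicCosets p d n) :=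
  AddSubgroup.quotient_finite_of_isOpen _ (isOpen_padicBall p d n)

noncomputable instance instMeasurableSpacePadicInt (p : ℕ) [Fact p.Prime] : MeasurableSpace ℤ_[p] := borel _

instance instBorelSpacePadicInt (p : ℕ) [Fact p.Prime] : BorelSpace ℤ_[p] := ⟨rfl⟩

/-- The normalized Haar measure on `ℤ_p^d`. -/
noncomputable def zpHaar (p d : ℕ) [Fact p.Prime] : Measure (Fin d → ℤ_[p]) :=
  Measure.addHaarMeasure ⊤

instance instIsFiniteMeasureZpHaar (p d : ℕ) [Fact p.Prime] : IsFiniteMeasure (zpHaar p d) := by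
  unfold zpHaar; infer_instance

/-- The Hilbert space `L^2(ℤ_p^d)`. -/
abbrev L2Zp (p d : ℕ) [Fact p.Prime] : Type := Lp ℂ 2 (zpHaar p d)

/-! ### The Heisenberg group -/

/-- The Heisenberg group `ℍ_d(ℤ_p)`: triples `(x, y, z)` in `ℤ_p^d × ℤ_p^d × ℤ_p`. -/
@[ext]
structure Heis (p d : ℕ) [Fact p.Prime] : Type where
  x : Fin d → ℤ_[p]
  y : Fin d → ℤ_[p]
  z : ℤ_[p]

namespace Heis

variable {p d : ℕ} [Fact p.Prime]

/-- `(x, y, z) ⋆ (x', y', z') = (x + x', y + y', z + z' + x · y')`. -/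
noncomputable instance instGroup : Group (Heis p d) where
  mul g g' := ⟨g.x + g'.x, g.y + g'.y, g.z + g'.z + g.x ⬝ᵥ g'.y⟩
  one := ⟨0, 0, 0⟩
  inv g := ⟨-g.x, -g.y, -g.z + g.x ⬝ᵥ g.y⟩
  mul_assoc a b c := by
    apply Heis.ext
    · exact add_assoc _ _ _
    · exact add_assoc _ _ _
    · change a.z + b.z + a.x ⬝ᵥ b.y + c.z + (a.x + b.x) ⬝ᵥ c.y
        = a.z + (b.z + c.z + b.x ⬝ᵥ c.y) + a.x ⬝ᵥ (b.y + c.y)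
      rw [add_dotProduct, dotProduct_add]; ring
  one_mul a := by
    apply Heis.ext
    · exact zero_add _
    · exact zero_add _
    · change 0 + a.z + 0 ⬝ᵥ a.y = a.z
      simp
  mul_one a := by
    apply Heis.ext
    · exact add_zero _
    · exact add_zero _
    · change a.z + 0 + a.x ⬝ᵥ 0 = a.z
      simp
  inv_mul_cancel a := by
    apply Heis.ext
    · exact neg_add_cancel _
    · exact neg_add_cancel _
    · change -a.z + a.x ⬝ᵥ a.y + a.z + (-a.x) ⬝ᵥ a.y = 0
      rw [neg_dotProduct]; ring

/-- The coordinates, as an equivalence with `ℤ_p^d × ℤ_p^d × ℤ_p`. -/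
def equivProd : Heis p d ≃ (Fin d → ℤ_[p]) × (Fin d → ℤ_[p]) × ℤ_[p] where
  toFun g := (g.x, g.y, g.z)
  invFun t := ⟨t.1, t.2.1, t.2.2⟩
  left_inv _ := rfl
  right_inv _ := rfl

/-- The product topology. -/
noncomputable instance instTopologicalSpace : TopologicalSpace (Heis p d) :=
  TopologicalSpace.induced equivProd inferInstance

/-- The coordinates, as a homeomorphism. -/
noncomputable def homeoProd : Heis p d ≃ₜ (Fin d → ℤ_[p]) × (Fin d → ℤ_[p]) × ℤ_[p] :=
  equivProd.toHomeomorphOfIsInducing ⟨rfl⟩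

theorem continuous_x : Continuous (fun g : Heis p d => g.x) :=
  continuous_fst.comp homeoProd.continuous

theorem continuous_y : Continuous (fun g : Heis p d => g.y) :=
  (continuous_fst.comp continuous_snd).comp homeoProd.continuous

theorem continuous_z : Continuous (fun g : Heis p d => g.z) :=
  (continuous_snd.comp continuous_snd).comp homeoProd.continuous

instance instCompactSpace : CompactSpace (Heis p d) := homeoProd.symm.compactSpace

instance instIsTopologicalGroup : IsTopologicalGroup (Heis p d) where
  continuous_mul := by
    refine homeoProd.isInducing.continuous_iff.2 ?_
    have hx := (continuous_x (p := p) (d := d))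
    have hy := (continuous_y (p := p) (d := d))
    have hz := (continuous_z (p := p) (d := d))
    have h1 := hx.comp (continuous_fst (X := Heis p d) (Y := Heis p d))
    have h2 := hx.comp (continuous_snd (X := Heis p d) (Y := Heis p d))
    have h3 := hy.comp (continuous_fst (X := Heis p d) (Y := Heis p d))
    have h4 := hy.comp (continuous_snd (X := Heis p d) (Y := Heis p d))
    have h5 := hz.comp (continuous_fst (X := Heis p d) (Y := Heis p d))
    have h6 := hz.comp (continuous_snd (X := Heis p d) (Y := Heis p d))
    exact (h1.add h2).prodMk ((h3.add h4).prodMk ((h5.add h6).add (h1.dotProduct h4)))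
  continuous_inv := by
    refine homeoProd.isInducing.continuous_iff.2 ?_
    have hx := (continuous_x (p := p) (d := d))
    have hy := (continuous_y (p := p) (d := d))
    have hz := (continuous_z (p := p) (d := d))
    exact hx.neg.prodMk (hy.neg.prodMk (hz.neg.add (hx.dotProduct hy)))

noncomputable instance instMeasurableSpace : MeasurableSpace (Heis p d) := borel _

instance instBorelSpace : BorelSpace (Heis p d) := ⟨rfl⟩

end Heis

/-- The normalized Haar measure on `ℍ_d`. -/
noncomputable def heisHaar (p d : ℕ) [Fact p.Prime] : Measure (Heis p d) :=
  Measure.haarMeasure ⊤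

/-- The subgroup `ℍ_d(p^n ℤ_p)`, as a set. -/
def heisBall (p d : ℕ) [Fact p.Prime] (n : ℕ) : Set (Heis p d) :=
  {k | k.x ∈ padicBall p d n ∧ k.y ∈ padicBall p d n ∧ (p : ℤ_[p]) ^ n ∣ k.z}

/-- The space `𝒟_n(ℍ_d)` of functions on `ℍ_d` that are invariant under right translations by
`ℍ_d(p^n ℤ_p)`. -/
noncomputable def smoothFun (p d : ℕ) [Fact p.Prime] (n : ℕ) : Submodule ℂ (Heis p d → ℂ) where
  carrier := {f | ∀ g k : Heis p d, k ∈ heisBall p d n → f (g * k) = f g}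
  zero_mem' := fun _ _ _ => rfl
  add_mem' := fun ha hb g k hk => by
    rw [Pi.add_apply, Pi.add_apply, ha g k hk, hb g k hk]
  smul_mem' := fun c f hf g k hk => by
    rw [Pi.smul_apply, Pi.smul_apply, hf g k hk]

/-! ### Unitary representations and the unitary dual -/

/-- A (strongly continuous) unitary representation of `G` on `H`. -/
structure UnitaryRep (G : Type*) [Group G] [TopologicalSpace G]
    (H : Type*) [NormedAddCommGroup H] [InnerProductSpace ℂ H] where
  toHom : G →* (H ≃ₗᵢ[ℂ] H)
  continuous_apply : ∀ v : H, Continuous fun g => toHom g v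

namespace UnitaryRep

variable {G : Type*} [Group G] [TopologicalSpace G]

/-- Irreducibility: `H ≠ 0`, and the only closed invariant subspaces are `0` and `H`. -/
def IsIrreducible {H : Type*} [NormedAddCommGroup H] [InnerProductSpace ℂ H]
    (π : UnitaryRep G H) : Prop :=
  Nontrivial H ∧ ∀ W : Submodule ℂ H, IsClosed (W : Set H) →
    (∀ g, ∀ v ∈ W, π.toHom g v ∈ W) → W = ⊥ ∨ W = ⊤

/-- Unitary equivalence. -/
def Equivalent {H H' : Type*} [NormedAddCommGroup H] [InnerProductSpace ℂ H]
    [NormedAddCommGroup H'] [InnerProductSpace ℂ H']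
    (π : UnitaryRep G H) (π' : UnitaryRep G H') : Prop :=
  ∃ U : H ≃ₗᵢ[ℂ] H', ∀ g v, U (π.toHom g v) = π'.toHom g (U v)

end UnitaryRep

/-- An irreducible unitary representation of `G` on some complex Hilbert space. -/
structure UnitaryIrrep (G : Type*) [Group G] [TopologicalSpace G] where
  space : Type
  [normedAddCommGroup : NormedAddCommGroup space]
  [innerProductSpace : InnerProductSpace ℂ space]
  [completeSpace : CompleteSpace space]
  rep : UnitaryRep G space
  irreducible : rep.IsIrreducible

attribute [instance] UnitaryIrrep.normedAddCommGroup UnitaryIrrep.innerProductSpace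
  UnitaryIrrep.completeSpace

/-- Unitary equivalence of irreducible unitary representations. -/
instance instSetoidUnitaryIrrep (G : Type*) [Group G] [TopologicalSpace G] :
    Setoid (UnitaryIrrep G) where
  r π π' := π.rep.Equivalent π'.rep
  iseqv :=
    { refl := fun _ => ⟨LinearIsometryEquiv.refl ℂ _, fun _ _ => rfl⟩
      symm := fun {_ _} ⟨U, hU⟩ => ⟨U.symm, fun g v => by
        rw [LinearIsometryEquiv.symm_apply_eq, hU, LinearIsometryEquiv.apply_symm_apply]⟩
      trans := fun {_ _ _} ⟨U, hU⟩ ⟨V, hV⟩ => ⟨U.trans V, fun g v => by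
        simp only [LinearIsometryEquiv.trans_apply, hU, hV]⟩ }

/-- The unitary dual of `G`. -/
def UnitaryDual (G : Type*) [Group G] [TopologicalSpace G] : Type _ :=
  Quotient (instSetoidUnitaryIrrep G)

/-! ### The parameter set -/

/-- The complete system of representatives of `ℚ_p / p^{-n} ℤ_p` formed by `1`, which represents
the trivial class, and the nonzero finite sums `∑_{k ≥ n + 1} c_k p^{-k}` with digits
`0 ≤ c_k < p`. -/
def padicReps (p : ℕ) [Fact p.Prime] (n : ℕ) : Set ℚ_[p] :=
  {1} ∪ {q | q ≠ 0 ∧ ∃ (N : ℕ) (c : ℕ → ℕ), (∀ k, c k < p) ∧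
    q = ∑ k ∈ Finset.Icc (n + 1) N, (c k : ℚ_[p]) * (p : ℚ_[p]) ^ (-(k : ℤ))}

/-- The natural number `-ϑ(λ)`, for `|λ|_p ≥ 1`. -/
noncomputable def padicLevel {p : ℕ} [Fact p.Prime] (lam : ℚ_[p]) : ℕ := (-lam.valuation).toNat

/-- The triples `(ξ, η, λ)` with `λ ∈ ℚ_p / ℤ_p` and `(ξ, η) ∈ ℚ_p^{2d} / p^{ϑ(λ)} ℤ_p^{2d}`,
classes being identified with their representatives. -/
@[ext]
structure HeisParam (p d : ℕ) [Fact p.Prime] : Type where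
  ξ : Fin d → ℚ_[p]
  η : Fin d → ℚ_[p]
  lam : ℚ_[p]
  lam_mem : lam ∈ padicReps p 0
  ξ_mem : ∀ i, ξ i ∈ padicReps p (padicLevel lam)
  η_mem : ∀ i, η i ∈ padicReps p (padicLevel lam)

/-- `‖(ξ, η, λ)‖_p`. -/
noncomputable def HeisParam.size {p d : ℕ} [Fact p.Prime] (t : HeisParam p d) : ℝ :=
  max (max ‖t.ξ‖ ‖t.η‖) ‖t.lam‖

/-- The finite index set `ℤ_p^d / p^{-ϑ(λ)} ℤ_p^d`. -/
abbrev HeisParam.Idx {p d : ℕ} [Fact p.Prime] (t : HeisParam p d) : Type :=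
  PadicCosets p d (padicLevel t.lam)

/-! ### The representation spaces -/

theorem measurableSet_padicCoset (p d : ℕ) [Fact p.Prime] (n : ℕ) (h : PadicCosets p d n) :
    MeasurableSet {u : Fin d → ℤ_[p] | (u : PadicCosets p d n) = h} := by
  have : DiscreteTopology (PadicCosets p d n) :=
    QuotientAddGroup.discreteTopology (isOpen_padicBall p d n)
  exact ((isOpen_discrete {h}).preimage QuotientAddGroup.continuous_mk).measurableSet

/-- `φ_h = |λ|_p^{d/2} 𝟙_{h + p^{-ϑ(λ)} ℤ_p^d}` in `L^2(ℤ_p^d)`. -/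
noncomputable def phi {p : ℕ} (d : ℕ) [Fact p.Prime] (lam : ℚ_[p])
    (h : PadicCosets p d (padicLevel lam)) : L2Zp p d :=
  indicatorConstLp 2 (measurableSet_padicCoset p d (padicLevel lam) h) (measure_ne_top _ _)
    ((‖lam‖ ^ ((d : ℝ) / 2) : ℝ) : ℂ)

/-- `ℋ_λ`, the span of the `φ_h`. -/
noncomputable def HLam {p : ℕ} (d : ℕ) [Fact p.Prime] (lam : ℚ_[p]) : Submodule ℂ (L2Zp p d) :=
  Submodule.span ℂ (Set.range (phi d lam))

instance instFiniteDimensionalHLam {p : ℕ} (d : ℕ) [Fact p.Prime] (lam : ℚ_[p]) :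
    FiniteDimensional ℂ (HLam d lam) :=
  FiniteDimensional.span_of_finite ℂ (Set.finite_range _)

instance instCompleteSpaceHLam {p : ℕ} (d : ℕ) [Fact p.Prime] (lam : ℚ_[p]) :
    CompleteSpace (HLam d lam) := FiniteDimensional.complete ℂ _

/-- `φ_h` as an element of `ℋ_λ`. -/
noncomputable def phiH {p : ℕ} (d : ℕ) [Fact p.Prime] (lam : ℚ_[p])
    (h : PadicCosets p d (padicLevel lam)) : HLam d lam :=
  ⟨phi d lam h, Submodule.subset_span ⟨h, rfl⟩⟩

/-- The matrix coefficient `π_{h h'}(g) = (π(g) φ_h, φ_{h'})_{L^2(ℤ_p^d)}`, the inner product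
being linear in its first argument (Mathlib's `inner` is linear in its second one). -/
noncomputable def matCoeff {p d : ℕ} [Fact p.Prime] {lam : ℚ_[p]}
    (π : UnitaryRep (Heis p d) (HLam d lam)) (h h' : PadicCosets p d (padicLevel lam))
    (g : Heis p d) : ℂ :=
  inner ℂ (phiH d lam h') (π.toHom g (phiH d lam h))

/-- The character `χ_π(g) = Tr π(g)`. -/
noncomputable def repCharacter {p d : ℕ} [Fact p.Prime] {lam : ℚ_[p]}
    (π : UnitaryRep (Heis p d) (HLam d lam)) (g : Heis p d) : ℂ :=
  LinearMap.trace ℂ (HLam d lam) (π.toHom g).toLinearEquiv.toLinearMap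

/-- `π` acts on `ℋ_λ` by
`π(x, y, z) φ (u) = e^{2 π i {ξ · x + η · y + λ (z + u · y)}_p} φ(u + x)`. -/
def ActsByFormula {p d : ℕ} [Fact p.Prime] (t : HeisParam p d)
    (π : UnitaryRep (Heis p d) (HLam d t.lam)) : Prop :=
  ∀ (g : Heis p d) (φ : HLam d t.lam),
    ((π.toHom g φ : L2Zp p d) : (Fin d → ℤ_[p]) → ℂ) =ᵐ[zpHaar p d] fun u =>
      padicExp (t.ξ ⬝ᵥ vecQ g.x + t.η ⬝ᵥ vecQ g.y + t.lam * ((g.z : ℚ_[p]) + vecQ u ⬝ᵥ vecQ g.y))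
        * ((φ : L2Zp p d) : (Fin d → ℤ_[p]) → ℂ) (u + g.x)

/-- The index set of the matrix coefficients of the representations with
`‖(ξ, η, λ)‖_p ≤ p^n`. -/
abbrev CoeffIdx (p d : ℕ) [Fact p.Prime] (n : ℕ) : Type :=
  Σ t : {t : HeisParam p d // t.size ≤ (p : ℝ) ^ n}, t.1.Idx × t.1.Idx

/-- The normalized matrix coefficients `|λ|_p^{d/2} (π_{(ξ, η, λ)})_{h h'}`. -/
noncomputable def normCoeff {p d : ℕ} [Fact p.Prime]
    (π : ∀ t : HeisParam p d, UnitaryRep (Heis p d) (HLam d t.lam)) (n : ℕ)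
    (j : CoeffIdx p d n) (g : Heis p d) : ℂ :=
  ((‖j.1.1.lam‖ ^ ((d : ℝ) / 2) : ℝ) : ℂ) * matCoeff (π j.1.1) j.2.1 j.2.2 g

/-!
The representations are built in coordinates. The `φ_h` are an orthonormal basis of `ℋ_λ`, and the
elements of `ℋ_λ` are `|λ|_p^{d/2}` times functions on the finite set `ℤ_p^d / p^{-ϑ(λ)} ℤ_p^d`
(`coeFn_HLam`). There `π(x, y, z)` is a translation by `x` followed by multiplication by a phase
(`heisPhase`), the phases satisfy a cocycle identity (`heisPhase_mul`), and the formulas for the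
action, the matrix coefficients and the character can be read off. The character needs
`∑_k e^{2 π i {λ k · y}_p} = |λ|_p^d 𝟙(y)` (`sum_padicExp_mul_dotProduct`). The same sum gives
irreducibility: averaging `π(0, y, 0)` against a character of `y` projects onto a single line
`ℂ φ_k`, and the translations `π(x, 0, 0)` permute these lines.

Inequivalence: the character of `π_{(ξ, η, λ)}` determines `λ` modulo `ℤ_p` and `(ξ, η)` modulo
`p^{ϑ(λ)} ℤ_p^{2d}`, and the chosen representatives of these classes are unique
(`padicReps_unique`).

Orthogonality of the matrix coefficients (`integral_normCoeff`): a left translation by `g₀`, with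
`x`-coordinate in `p^{-ϑ(λ)} ℤ_p^d`, multiplies a coefficient by a phase, so the integral of a
product vanishes unless the two phases agree for all such `g₀`. The norms are the measures of
cosets.

Completeness (`span_normCoeff`): `𝒟_n` consists of the functions of the coordinates modulo `p^n`,
because `ℍ_d(p^n ℤ_p)`-cosets are products of cosets. Fourier expansion in each coordinate shows
that it is spanned by the functions `e^{2 π i {a · x + b · y + c z}_p}` with `‖(a, b, c)‖_p ≤ p^n`.
If `(ξ, η, λ)` represents `(a, b, c)` and `b - η = λ w` with `w ∈ ℤ_p^d`, such a function is a
combination of the coefficients of `π_{(ξ, η, λ)}` with `h' = w`.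

Exhaustion (`exists_equivalent_heisRep`): let `ρ` be irreducible and `v ≠ 0`. The function
`g ↦ (v, ρ(g) v)` is continuous and positive at `1`, so it is not orthogonal to the indicator
function of a small subgroup `ℍ_d(p^n ℤ_p)`; by completeness it is not orthogonal to some
coefficient of some `π`. Thus one of the averages `∫ ρ(g) A π(g)⁻¹ dg`, with `A` of rank one, is a
nonzero intertwining operator, and by Schur's lemma a multiple of a unitary equivalence. No
finiteness of the dimension of `ρ` has to be known in advance.
-/

/-! ### The character `padicExp` -/

section Character

variable {p : ℕ} [Fact p.Prime]

theorem one_lt_prime_cast : (1 : ℝ) < p := by exact_mod_cast (Fact.out : p.Prime).one_lt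

theorem prime_cast_pos : (0 : ℝ) < p := zero_lt_one.trans one_lt_prime_cast

theorem prime_cast_padic_ne_zero : (p : ℚ_[p]) ≠ 0 := by
  exact_mod_cast (Fact.out : p.Prime).ne_zero

theorem padicFract_eq_div (u : ℚ_[p]) : ∃ a k : ℕ, padicFract u = (a : ℚ) / (p : ℚ) ^ k :=
  ⟨_, _, rfl⟩

theorem norm_sub_padicFract_le_one (u : ℚ_[p]) : ‖u - ((padicFract u : ℚ) : ℚ_[p])‖ ≤ 1 := by
  set k := (-u.valuation).toNat with hk
  set w : ℤ_[p] := ⟨u * (p : ℚ_[p]) ^ k, padic_norm_mul_pow_le_one u⟩ with hw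
  have h1 := PadicInt.appr_spec k w
  rw [← PadicInt.norm_le_pow_iff_mem_span_pow, PadicInt.norm_def] at h1
  have h2 : u - ((padicFract u : ℚ) : ℚ_[p]) =
      ((w - (w.appr k : ℤ_[p]) : ℤ_[p]) : ℚ_[p]) / (p : ℚ_[p]) ^ k := by
    have : ((padicFract u : ℚ) : ℚ_[p]) = (w.appr k : ℚ_[p]) / (p : ℚ_[p]) ^ k := by
      simp [padicFract, hw, hk]
    have hp := pow_ne_zero k (prime_cast_padic_ne_zero (p := p))
    rw [this, eq_div_iff hp, sub_mul, div_mul_cancel₀ _ hp]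
    rw [PadicInt.coe_sub, PadicInt.coe_natCast]
  rw [h2, norm_div, norm_pow, Padic.norm_p, inv_pow, div_inv_eq_mul]
  have hpk : (0 : ℝ) < (p : ℝ) ^ k := pow_pos prime_cast_pos _
  calc _ ≤ (p : ℝ) ^ (-k : ℤ) * (p : ℝ) ^ k := by gcongr
    _ = 1 := by rw [zpow_neg, zpow_natCast, inv_mul_cancel₀ hpk.ne']

/-- A rational number whose denominator is a power of `p` and which is a `p`-adic integer is
an integer. -/
theorem exists_int_of_norm_le_one {q : ℚ} (a : ℤ) (k : ℕ) (hq : q = (a : ℚ) / (p : ℚ) ^ k)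
    (h : ‖(q : ℚ_[p])‖ ≤ 1) : ∃ n : ℤ, q = n := by
  have hpk : (0 : ℝ) < (p : ℝ) ^ k := pow_pos prime_cast_pos _
  have h1 : ‖(a : ℚ_[p])‖ ≤ (p : ℝ) ^ (-k : ℤ) := by
    rw [hq] at h
    push_cast at h
    rw [norm_div, norm_pow, Padic.norm_p, inv_pow, div_inv_eq_mul] at h
    rw [zpow_neg, zpow_natCast]
    rwa [← le_div_iff₀ hpk, one_div] at h
  obtain ⟨b, rfl⟩ := (Padic.norm_int_le_pow_iff_dvd a k).1 h1
  refine ⟨b, ?_⟩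
  have : (p : ℚ) ^ k ≠ 0 := pow_ne_zero _ (by exact_mod_cast (Fact.out : p.Prime).ne_zero)
  rw [hq]
  push_cast
  field_simp

theorem exp_two_pi_int_cast (n : ℤ) :
    Complex.exp (2 * Real.pi * Complex.I * (((n : ℤ) : ℚ) : ℂ)) = 1 := by
  rw [Complex.exp_eq_one_iff]
  exact ⟨n, by push_cast; ring⟩

theorem padicExp_add (u v : ℚ_[p]) : padicExp (u + v) = padicExp u * padicExp v := by
  obtain ⟨a, k, ha⟩ := padicFract_eq_div u
  obtain ⟨b, l, hb⟩ := padicFract_eq_div v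
  obtain ⟨c, m, hc⟩ := padicFract_eq_div (u + v)
  have hp : (p : ℚ) ≠ 0 := by exact_mod_cast (Fact.out : p.Prime).ne_zero
  -- `{u + v} - {u} - {v}` is a `p`-adic integer with a power of `p` as denominator.
  obtain ⟨n, hn⟩ := exists_int_of_norm_le_one (p := p)
    (q := padicFract (u + v) - padicFract u - padicFract v)
    (c * p ^ k * p ^ l - a * p ^ m * p ^ l - b * p ^ m * p ^ k) (m + k + l)
    (by rw [ha, hb, hc]; push_cast; field_simp; ring) (by
      have : ((padicFract (u + v) - padicFract u - padicFract v : ℚ) : ℚ_[p]) =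
          -((u + v) - (padicFract (u + v) : ℚ_[p])) + ((u - (padicFract u : ℚ_[p])) +
            (v - (padicFract v : ℚ_[p]))) := by push_cast; ring
      rw [this]
      refine (IsUltrametricDist.norm_add_le_max _ _).trans (max_le ?_ ?_)
      · rw [norm_neg]; exact norm_sub_padicFract_le_one _
      · exact (IsUltrametricDist.norm_add_le_max _ _).trans
          (max_le (norm_sub_padicFract_le_one _) (norm_sub_padicFract_le_one _)))
  have : padicFract (u + v) = padicFract u + padicFract v + (n : ℚ) := by rw [← hn]; ring
  unfold padicExp
  rw [this, ← Complex.exp_add, ← mul_one (Complex.exp (_ + _)), ← exp_two_pi_int_cast n,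
    ← Complex.exp_add]
  congr 1
  push_cast
  ring

theorem padicExp_eq_one_iff {u : ℚ_[p]} : padicExp u = 1 ↔ ‖u‖ ≤ 1 := by
  constructor
  · intro h
    unfold padicExp at h
    obtain ⟨n, hn⟩ := Complex.exp_eq_one_iff.1 h
    have h1 : padicFract u = (n : ℚ) := by
      have : ((padicFract u : ℚ) : ℂ) = n := by
        have h2 : (2 * Real.pi * Complex.I : ℂ) ≠ 0 := Complex.two_pi_I_ne_zero
        apply mul_left_cancel₀ h2
        rw [hn]; ring
      exact_mod_cast this
    have h2 : u = (u - ((padicFract u : ℚ) : ℚ_[p])) + ((n : ℤ) : ℚ_[p]) := by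
      rw [h1]; push_cast; ring
    rw [h2]
    exact (IsUltrametricDist.norm_add_le_max _ _).trans
      (max_le (norm_sub_padicFract_le_one _) (Padic.norm_int_le_one n))
  · intro h
    obtain ⟨a, k, ha⟩ := padicFract_eq_div u
    obtain ⟨n, hn⟩ := exists_int_of_norm_le_one (p := p) (q := padicFract u) a k
      (by simpa using ha) (by
        have : ((padicFract u : ℚ) : ℚ_[p]) = -(u - ((padicFract u : ℚ) : ℚ_[p])) + u := by ring
        rw [this]
        refine (IsUltrametricDist.norm_add_le_max _ _).trans (max_le ?_ h)
        rw [norm_neg]; exact norm_sub_padicFract_le_one _)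
    unfold padicExp
    rw [hn, exp_two_pi_int_cast]

theorem padicExp_zero : padicExp (0 : ℚ_[p]) = 1 := padicExp_eq_one_iff.2 (by simp)

theorem norm_padicExp (u : ℚ_[p]) : ‖padicExp u‖ = 1 := by
  unfold padicExp
  rw [show (2 * Real.pi * Complex.I * ((padicFract u : ℚ) : ℂ)) =
    ((2 * Real.pi * (padicFract u : ℝ) : ℝ) : ℂ) * Complex.I by push_cast; ring]
  exact Complex.norm_exp_ofReal_mul_I _

theorem padicExp_ne_zero (u : ℚ_[p]) : padicExp u ≠ 0 := by
  rw [← norm_ne_zero_iff, norm_padicExp]; exact one_ne_zero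

theorem padicExp_neg (u : ℚ_[p]) : padicExp (-u) = (padicExp u)⁻¹ := by
  rw [eq_comm, inv_eq_iff_eq_inv, ← mul_eq_one_iff_eq_inv₀ (padicExp_ne_zero _), ← padicExp_add, add_neg_cancel, padicExp_zero]

theorem conj_padicExp (u : ℚ_[p]) : (starRingEnd ℂ) (padicExp u) = padicExp (-u) := by
  rw [padicExp_neg, Complex.inv_eq_conj (norm_padicExp u)]

theorem padicExp_mul_conj (u : ℚ_[p]) : padicExp u * (starRingEnd ℂ) (padicExp u) = 1 := by
  rw [conj_padicExp, ← padicExp_add, add_neg_cancel, padicExp_zero]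

theorem padicExp_eq_iff {u v : ℚ_[p]} : padicExp u = padicExp v ↔ ‖u - v‖ ≤ 1 := by
  rw [← padicExp_eq_one_iff, sub_eq_add_neg, padicExp_add, padicExp_neg,
    mul_inv_eq_one₀ (padicExp_ne_zero v)]

theorem continuous_padicExp : Continuous (padicExp : ℚ_[p] → ℂ) := by
  apply IsLocallyConstant.continuous
  rw [IsLocallyConstant.iff_eventually_eq]
  intro u
  filter_upwards [Metric.ball_mem_nhds u one_pos] with v hv
  rw [padicExp_eq_iff]
  rw [Metric.mem_ball, dist_eq_norm] at hv
  exact hv.le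

end Character

/-! ### Representatives of `ℚ_p / p^{-n} ℤ_p` -/

section Representatives

theorem sum_digits_eq_mod (b A r : ℕ) :
    ∑ j ∈ Finset.range r, (A / b ^ j % b) * b ^ j = A % b ^ r := by
  induction r with
  | zero => simp [Nat.mod_one]
  | succ r ih => rw [Finset.sum_range_succ, ih, Nat.mod_pow_succ, mul_comm]

variable {p : ℕ} [Fact p.Prime]

theorem padic_norm_sub_le_max (u v : ℚ_[p]) : ‖u - v‖ ≤ max ‖u‖ ‖v‖ := by
  rw [sub_eq_add_neg, ← norm_neg v]
  exact IsUltrametricDist.norm_add_le_max _ _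

theorem norm_prime_pow_inv (N : ℕ) : ‖((p : ℚ_[p]) ^ N)⁻¹‖ = (p : ℝ) ^ N := by
  rw [norm_inv, norm_pow, Padic.norm_p, inv_pow, inv_inv]

/-- A sum of digits in places `n + 1, …, N` after the point is `A / p^N` with `A < p^{N-n}`. -/
theorem exists_digit_sum_eq {n N : ℕ} (hN : n ≤ N) (c : ℕ → ℕ) (hc : ∀ k, c k < p) :
    ∃ A : ℕ, A < p ^ (N - n) ∧
      ∑ k ∈ Finset.Icc (n + 1) N, (c k : ℚ_[p]) * (p : ℚ_[p]) ^ (-(k : ℤ)) =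
        A * ((p : ℚ_[p]) ^ N)⁻¹ := by
  have hp := prime_cast_padic_ne_zero (p := p)
  induction N, hN using Nat.le_induction with
  | base => exact ⟨0, by simp, by simp⟩
  | succ N hN ih =>
    obtain ⟨A, hA, h⟩ := ih
    refine ⟨p * A + c (N + 1), ?_, ?_⟩
    · rw [Nat.succ_sub hN, pow_succ']
      calc p * A + c (N + 1) < p * A + p := by have := hc (N + 1); lia
        _ = p * (A + 1) := by ring
        _ ≤ _ := Nat.mul_le_mul_left _ hA
    · rw [Finset.sum_Icc_succ_top (by lia), h, zpow_neg, zpow_natCast]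
      push_cast
      field_simp
      ring

theorem exists_digits {n N A : ℕ} (hA : A < p ^ (N - n)) :
    ∃ c : ℕ → ℕ, (∀ k, c k < p) ∧ (A : ℚ_[p]) * ((p : ℚ_[p]) ^ N)⁻¹ =
      ∑ k ∈ Finset.Icc (n + 1) N, (c k : ℚ_[p]) * (p : ℚ_[p]) ^ (-(k : ℤ)) := by
  have hp := prime_cast_padic_ne_zero (p := p)
  refine ⟨fun k => A / p ^ (N - k) % p, fun k => Nat.mod_lt _ (Fact.out : p.Prime).pos, ?_⟩
  have h1 := sum_digits_eq_mod p A (N - n)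
  rw [Nat.mod_eq_of_lt hA] at h1
  have h2 : (A : ℚ_[p]) = ∑ j ∈ Finset.range (N - n), ((A / p ^ j % p : ℕ) : ℚ_[p]) * (p : ℚ_[p]) ^ j := by
    conv_lhs => rw [← h1]
    push_cast
    rfl
  rw [h2, Finset.sum_mul]
  refine Finset.sum_bij' (fun j _ => N - j) (fun k _ => N - k) ?_ ?_ ?_ ?_ ?_
  · intro j hj; simp only [Finset.mem_range, Finset.mem_Icc] at *; lia
  · intro j hj; simp only [Finset.mem_range, Finset.mem_Icc] at *; lia
  · intro j hj; simp only [Finset.mem_range] at *; lia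
  · intro j hj; simp only [Finset.mem_Icc] at *; lia
  · intro j hj
    simp only [Finset.mem_range] at hj
    have : N - (N - j) = j := by lia
    dsimp only
    rw [this, mul_assoc]
    congr 1
    rw [zpow_neg, zpow_natCast, ← div_eq_mul_inv, div_eq_iff (pow_ne_zero _ hp),
      inv_mul_eq_div, eq_div_iff (pow_ne_zero _ hp), ← pow_add]
    congr 1; lia

/-- Every class of `ℚ_p / p^{-n} ℤ_p` has a representative, which lies in `p^{-N} ℤ_p` if the class
does. -/
theorem exists_padicReps (n N : ℕ) (hnN : n ≤ N) (u : ℚ_[p]) (hu : ‖u‖ ≤ (p : ℝ) ^ N) :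
    ∃ q ∈ padicReps p n, ‖u - q‖ ≤ (p : ℝ) ^ n ∧ ‖q‖ ≤ (p : ℝ) ^ N := by
  have hp := prime_cast_padic_ne_zero (p := p)
  have hp1 := (one_lt_prime_cast (p := p)).le
  by_cases h : ‖u‖ ≤ (p : ℝ) ^ n
  · refine ⟨1, Or.inl rfl, ?_, ?_⟩
    · exact (padic_norm_sub_le_max _ _).trans
        (max_le h (by rw [norm_one]; exact one_le_pow₀ hp1))
    · rw [norm_one]; exact one_le_pow₀ hp1
  -- The first `N - n` digits of `p^N u` are the digits of `u` in the places `n + 1, …, N`.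
  · set w : ℤ_[p] := ⟨u * (p : ℚ_[p]) ^ N, by
      rw [norm_mul, norm_pow, Padic.norm_p, inv_pow, ← div_eq_mul_inv]
      exact div_le_one_of_le₀ hu (pow_nonneg prime_cast_pos.le _)⟩ with hw
    have h1 := PadicInt.appr_spec (N - n) w
    rw [← PadicInt.norm_le_pow_iff_mem_span_pow, PadicInt.norm_def] at h1
    obtain ⟨c, hc, hA⟩ := exists_digits (PadicInt.appr_lt w (N - n))
    have h2 : ‖u - (w.appr (N - n) : ℚ_[p]) * ((p : ℚ_[p]) ^ N)⁻¹‖ ≤ (p : ℝ) ^ n := by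
      have : u - (w.appr (N - n) : ℚ_[p]) * ((p : ℚ_[p]) ^ N)⁻¹ =
          ((w - (w.appr (N - n) : ℤ_[p]) : ℤ_[p]) : ℚ_[p]) * ((p : ℚ_[p]) ^ N)⁻¹ := by
        have hpn := pow_ne_zero N hp
        rw [PadicInt.coe_sub, sub_mul]
        simp only [hw, PadicInt.coe_natCast]
        rw [mul_assoc, mul_inv_cancel₀ hpn, mul_one]
      rw [this, norm_mul, norm_prime_pow_inv]
      calc _ ≤ (p : ℝ) ^ (-(N - n : ℕ) : ℤ) * (p : ℝ) ^ N := by gcongr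
        _ = (p : ℝ) ^ n := by
          rw [← zpow_natCast, ← zpow_add₀ prime_cast_pos.ne', ← zpow_natCast]
          congr 1; lia
    refine ⟨_, Or.inr ⟨?_, N, c, hc, hA⟩, h2, ?_⟩
    · intro h0
      rw [h0, sub_zero] at h2
      exact h h2
    · have : (w.appr (N - n) : ℚ_[p]) * ((p : ℚ_[p]) ^ N)⁻¹ =
          u - (u - (w.appr (N - n) : ℚ_[p]) * ((p : ℚ_[p]) ^ N)⁻¹) := by ring
      rw [this]
      exact (padic_norm_sub_le_max _ _).trans
        (max_le hu (h2.trans (pow_le_pow_right₀ hp1 hnN)))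

/-- A nonzero representative, written over a large power of `p`. -/
theorem exists_large_denominator {n : ℕ} {q : ℚ_[p]} (hq : q ∈ padicReps p n) (hq1 : q ≠ 1) :
    ∃ N₀, ∀ N, N₀ ≤ N → n ≤ N ∧ ∃ A : ℕ, A < p ^ (N - n) ∧ q = A * ((p : ℚ_[p]) ^ N)⁻¹ := by
  have hp := prime_cast_padic_ne_zero (p := p)
  rcases hq with hq | ⟨h0, N, c, hc, rfl⟩
  · exact absurd hq hq1
  · have hnN : n ≤ N := by
      by_contra h
      exact h0 (by rw [Finset.Icc_eq_empty (by lia), Finset.sum_empty])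
    obtain ⟨A, hA, h⟩ := exists_digit_sum_eq hnN c hc
    refine ⟨N, fun M hM => ⟨hnN.trans hM, A * p ^ (M - N), ?_, ?_⟩⟩
    · rw [show M - n = (N - n) + (M - N) by lia, pow_add]
      exact Nat.mul_lt_mul_of_pos_right hA (pow_pos (Fact.out : p.Prime).pos _)
    · rw [h]
      obtain ⟨j, rfl⟩ := Nat.exists_eq_add_of_le hM
      rw [Nat.add_sub_cancel_left, pow_add]
      push_cast
      field_simp

/-- Distinct fractions `A / p^N` with `0 ≤ A < p^{N-n}` are incongruent modulo `p^{-n} ℤ_p`. -/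
theorem eq_of_norm_sub_le {n N A B : ℕ} (hn : n ≤ N) (hA : A < p ^ (N - n)) (hB : B < p ^ (N - n))
    (h : ‖(A : ℚ_[p]) * ((p : ℚ_[p]) ^ N)⁻¹ - B * ((p : ℚ_[p]) ^ N)⁻¹‖ ≤ (p : ℝ) ^ n) : A = B := by
  have hpN : (0 : ℝ) < (p : ℝ) ^ N := pow_pos prime_cast_pos _
  rw [← sub_mul, norm_mul, norm_prime_pow_inv, ← le_div_iff₀ hpN] at h
  have h1 : ‖(((A : ℤ) - (B : ℤ) : ℤ) : ℚ_[p])‖ ≤ (p : ℝ) ^ (-(N - n : ℕ) : ℤ) := by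
    push_cast
    refine h.trans (le_of_eq ?_)
    rw [div_eq_iff hpN.ne', ← zpow_natCast, ← zpow_natCast, ← zpow_add₀ prime_cast_pos.ne']
    congr 1; lia
  rw [Padic.norm_int_le_pow_iff_dvd] at h1
  have h3 := Int.eq_zero_of_abs_lt_dvd h1 (by
    rw [abs_lt]; constructor <;> · zify at hA hB; lia)
  lia

/-- The trivial class contains no representative except `1`. -/
theorem eq_one_of_norm_le_pow {n : ℕ} {q : ℚ_[p]} (hq : q ∈ padicReps p n)
    (h : ‖q‖ ≤ (p : ℝ) ^ n) : q = 1 := by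
  by_contra h1
  obtain ⟨N, hN⟩ := exists_large_denominator hq h1
  obtain ⟨hn, A, hA, rfl⟩ := hN N le_rfl
  have := eq_of_norm_sub_le hn hA (B := 0) (pow_pos (Fact.out : p.Prime).pos _) (by simpa using h)
  subst this
  rcases hq with hq | ⟨h0, -⟩
  · exact h1 hq
  · simp at h0

theorem padicReps_unique {n : ℕ} {q q' : ℚ_[p]} (hq : q ∈ padicReps p n) (hq' : q' ∈ padicReps p n)
    (h : ‖q - q'‖ ≤ (p : ℝ) ^ n) : q = q' := by
  have hp1 := (one_lt_prime_cast (p := p)).le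
  by_cases h1 : q = 1
  · subst h1
    refine (eq_one_of_norm_le_pow hq' ?_).symm
    rw [show q' = 1 - (1 - q') by ring]
    exact (padic_norm_sub_le_max _ _).trans
      (max_le (by rw [norm_one]; exact one_le_pow₀ hp1) h)
  by_cases h2 : q' = 1
  · subst h2
    refine eq_one_of_norm_le_pow hq ?_
    rw [show q = (q - 1) + 1 by ring]
    exact (IsUltrametricDist.norm_add_le_max _ _).trans
      (max_le h (by rw [norm_one]; exact one_le_pow₀ hp1))
  obtain ⟨N, hN⟩ := exists_large_denominator hq h1
  obtain ⟨N', hN'⟩ := exists_large_denominator hq' h2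
  obtain ⟨hn, A, hA, hqA⟩ := hN (max N N') (le_max_left _ _)
  obtain ⟨-, B, hB, hqB⟩ := hN' (max N N') (le_max_right _ _)
  rw [hqA, hqB] at h ⊢
  rw [eq_of_norm_sub_le hn hA hB h]

/-- A representative `λ` satisfies `|λ|_p ≥ 1`, so that truncating `-ϑ(λ)` to a natural number loses
nothing. -/
theorem norm_eq_pow_padicLevel {lam : ℚ_[p]} (h : lam ∈ padicReps p 0) :
    ‖lam‖ = (p : ℝ) ^ padicLevel lam := by
  have h0 : lam ≠ 0 := by
    rcases h with h | h
    · rw [h]; exact one_ne_zero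
    · exact h.1
  have h1 : 1 ≤ ‖lam‖ := by
    by_contra h1
    have := eq_one_of_norm_le_pow h (by rw [pow_zero]; exact (not_le.1 h1).le)
    rw [this, norm_one] at h1
    exact h1 le_rfl
  rw [Padic.norm_eq_zpow_neg_valuation h0] at h1 ⊢
  have h2 : 0 ≤ -lam.valuation := by
    by_contra h2
    exact absurd h1 (not_le.2 (zpow_lt_one_of_neg₀ one_lt_prime_cast (not_le.1 h2)))
  rw [padicLevel, ← zpow_natCast, Int.toNat_of_nonneg h2]

theorem norm_pos_of_mem_padicReps {lam : ℚ_[p]} (h : lam ∈ padicReps p 0) : 0 < ‖lam‖ := by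
  rw [norm_eq_pow_padicLevel h]; exact pow_pos prime_cast_pos _

end Representatives

/-! ### Cosets of `p^n ℤ_p^d` and orthogonality of characters -/

section Cosets

variable {p d : ℕ} [Fact p.Prime]

noncomputable instance instFintypePadicCosets (n : ℕ) : Fintype (PadicCosets p d n) :=
  Fintype.ofFinite _

instance instDiscreteTopologyPadicCosets (n : ℕ) : DiscreteTopology (PadicCosets p d n) :=
  QuotientAddGroup.discreteTopology (isOpen_padicBall p d n)

theorem padicCoset_eq_iff {n : ℕ} {u v : Fin d → ℤ_[p]} :
    (u : PadicCosets p d n) = v ↔ u - v ∈ padicBall p d n := by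
  rw [QuotientAddGroup.eq, ← neg_mem_iff, neg_add, neg_neg, sub_eq_add_neg]

theorem out_sub_mem_padicBall {n : ℕ} (u : Fin d → ℤ_[p]) :
    (u : PadicCosets p d n).out - u ∈ padicBall p d n :=
  padicCoset_eq_iff.1 (Quotient.out_eq' _)

theorem mk_out_padicCoset {n : ℕ} (k : PadicCosets p d n) :
    ((k.out : Fin d → ℤ_[p]) : PadicCosets p d n) = k := Quotient.out_eq' k

theorem mem_padicBall_iff {n : ℕ} {u : Fin d → ℤ_[p]} :
    u ∈ padicBall p d n ↔ ∀ i, (p : ℤ_[p]) ^ n ∣ u i := Iff.rfl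

theorem pow_dvd_iff_norm_le {n : ℕ} {a : ℤ_[p]} :
    (p : ℤ_[p]) ^ n ∣ a ↔ (p : ℝ) ^ n * ‖(a : ℚ_[p])‖ ≤ 1 := by
  have hpn : (0 : ℝ) < (p : ℝ) ^ n := pow_pos prime_cast_pos _
  rw [← Ideal.mem_span_singleton, ← PadicInt.norm_le_pow_iff_mem_span_pow, PadicInt.norm_def,
    zpow_neg, zpow_natCast, ← one_div, le_div_iff₀ hpn, mul_comm]

theorem card_padicCosets (n : ℕ) : Fintype.card (PadicCosets p d n) = (p ^ n) ^ d := by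
  let f : (Fin d → ℤ_[p]) →+ (Fin d → ZMod (p ^ n)) :=
    (PadicInt.toZModPow n).toAddMonoidHom.compLeft (Fin d)
  have hf : Function.Surjective f := fun v =>
    ⟨fun i => (ZMod.ringHom_surjective (PadicInt.toZModPow (p := p) n) (v i)).choose,
      funext fun i => (ZMod.ringHom_surjective (PadicInt.toZModPow (p := p) n) (v i)).choose_spec⟩
  have hk : f.ker = padicBall p d n := by
    ext u
    rw [AddMonoidHom.mem_ker, mem_padicBall_iff, funext_iff]
    refine forall_congr' fun i => ?_
    rw [← Ideal.mem_span_singleton, ← PadicInt.ker_toZModPow, RingHom.mem_ker]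
    rfl
  have : NeZero (p ^ n) := ⟨pow_ne_zero _ (Fact.out : p.Prime).ne_zero⟩
  rw [← Nat.card_eq_fintype_card, PadicCosets, ← hk,
    Nat.card_congr (QuotientAddGroup.quotientKerEquivOfSurjective f hf).toEquiv]
  simp

theorem vecQ_add (u v : Fin d → ℤ_[p]) : vecQ (u + v) = vecQ u + vecQ v :=
  funext fun _ => PadicInt.coe_add _ _

theorem vecQ_sub (u v : Fin d → ℤ_[p]) : vecQ (u - v) = vecQ u - vecQ v :=
  funext fun _ => PadicInt.coe_sub _ _

theorem vecQ_zero : vecQ (0 : Fin d → ℤ_[p]) = 0 := funext fun _ => PadicInt.coe_zero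

theorem vecQ_dotProduct (u v : Fin d → ℤ_[p]) : vecQ u ⬝ᵥ vecQ v = ((u ⬝ᵥ v : ℤ_[p]) : ℚ_[p]) := by
  simp [dotProduct, vecQ]

theorem vecQ_single (i : Fin d) (a : ℤ_[p]) : vecQ (Pi.single i a) = Pi.single i (a : ℚ_[p]) := by
  ext j
  by_cases h : j = i
  · subst h; simp [vecQ]
  · simp [vecQ, h]

theorem norm_dotProduct_vecQ_le_one {a : Fin d → ℚ_[p]} {u : Fin d → ℤ_[p]}
    (h : ∀ i, ‖a i‖ * ‖(u i : ℚ_[p])‖ ≤ 1) : ‖a ⬝ᵥ vecQ u‖ ≤ 1 := by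
  refine IsUltrametricDist.norm_sum_le_of_forall_le_of_nonneg zero_le_one fun i _ => ?_
  rw [norm_mul]
  exact h i

theorem norm_dotProduct_vecQ_le_one_of_mem {n : ℕ} {a : Fin d → ℚ_[p]} {u : Fin d → ℤ_[p]}
    (ha : ∀ i, ‖a i‖ ≤ (p : ℝ) ^ n) (hu : u ∈ padicBall p d n) : ‖a ⬝ᵥ vecQ u‖ ≤ 1 :=
  norm_dotProduct_vecQ_le_one fun i =>
    (mul_le_mul_of_nonneg_right (ha i) (norm_nonneg _)).trans (pow_dvd_iff_norm_le.1 (hu i))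

/-- The annihilator of `p^n ℤ_p^d` under the pairing `e^{2 π i {a · u}_p}` is `p^{-n} ℤ_p^d`. -/
theorem norm_le_pow_of_padicExp_eq_one {n : ℕ} {a : Fin d → ℚ_[p]}
    (h : ∀ u ∈ padicBall p d n, padicExp (a ⬝ᵥ vecQ u) = 1) (i : Fin d) :
    ‖a i‖ ≤ (p : ℝ) ^ n := by
  have hpn : (0 : ℝ) < (p : ℝ) ^ n := pow_pos prime_cast_pos _
  have h1 := h (Pi.single i ((p : ℤ_[p]) ^ n)) (by
    intro j
    by_cases hj : j = i
    · subst hj; simp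
    · simp [hj])
  rw [vecQ_single, dotProduct_single, padicExp_eq_one_iff] at h1
  push_cast at h1
  rwa [norm_mul, norm_pow, Padic.norm_p, inv_pow, ← div_eq_mul_inv, div_le_one hpn] at h1

theorem padicExp_add_of_norm_le_one (u : ℚ_[p]) {v : ℚ_[p]} (hv : ‖v‖ ≤ 1) :
    padicExp (u + v) = padicExp u := by
  rw [padicExp_add, padicExp_eq_one_iff.2 hv, mul_one]

theorem norm_mul_dotProduct_le_one {n : ℕ} {lam : ℚ_[p]} (hlam : ‖lam‖ ≤ (p : ℝ) ^ n)
    {u : Fin d → ℤ_[p]} (hu : u ∈ padicBall p d n) (v : Fin d → ℤ_[p]) :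
    ‖lam * (vecQ u ⬝ᵥ vecQ v)‖ ≤ 1 := by
  rw [dotProduct_comm, ← smul_eq_mul, ← smul_dotProduct]
  refine norm_dotProduct_vecQ_le_one_of_mem (n := n) (fun i => ?_) hu
  rw [Pi.smul_apply, smul_eq_mul, norm_mul]
  exact (mul_le_of_le_one_right (norm_nonneg _) (PadicInt.norm_le_one _)).trans hlam

theorem padicExp_mul_dotProduct_out {n : ℕ} {lam : ℚ_[p]} (hlam : ‖lam‖ ≤ (p : ℝ) ^ n)
    (u v : Fin d → ℤ_[p]) :
    padicExp (lam * (vecQ (u : PadicCosets p d n).out ⬝ᵥ vecQ v)) =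
      padicExp (lam * (vecQ u ⬝ᵥ vecQ v)) := by
  rw [padicExp_eq_iff, ← mul_sub, ← sub_dotProduct, ← vecQ_sub]
  exact norm_mul_dotProduct_le_one hlam (out_sub_mem_padicBall u) v

/-- Orthogonality of the characters `k ↦ e^{2 π i {λ k · v}_p}` of `ℤ_p^d / p^n ℤ_p^d`, where
`|λ|_p = p^n`. -/
theorem sum_padicExp_mul_dotProduct {n : ℕ} {lam : ℚ_[p]} (hlam : ‖lam‖ = (p : ℝ) ^ n)
    (v : Fin d → ℤ_[p]) :
    ∑ k : PadicCosets p d n, padicExp (lam * (vecQ k.out ⬝ᵥ vecQ v)) =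
      (((p : ℝ) ^ n) ^ d : ℝ) * Set.indicator (padicBall p d n : Set (Fin d → ℤ_[p])) 1 v := by
  by_cases hv : v ∈ padicBall p d n
  · rw [Set.indicator_of_mem hv, Finset.sum_congr rfl (g := fun _ => 1)]
    · rw [Finset.sum_const, Finset.card_univ, card_padicCosets]
      simp
    · intro k _
      rw [padicExp_eq_one_iff, dotProduct_comm]
      exact norm_mul_dotProduct_le_one hlam.le hv _
  -- Some coordinate of `v` is not in `p^n ℤ_p`; shifting `k` by the corresponding basis vector
  -- multiplies the sum by a constant `c ≠ 1`.
  · rw [Set.indicator_of_notMem hv, mul_zero]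
    obtain ⟨i, hi⟩ := not_forall.1 (mt mem_padicBall_iff.2 hv)
    set c := padicExp (lam * (vecQ (Pi.single i 1) ⬝ᵥ vecQ v)) with hc
    have hc1 : c ≠ 1 := by
      rw [hc, Ne, padicExp_eq_one_iff, vecQ_single, single_dotProduct, PadicInt.coe_one, one_mul,
        norm_mul, hlam]
      exact mt pow_dvd_iff_norm_le.2 hi
    have h1 : ∑ k : PadicCosets p d n, padicExp (lam * (vecQ k.out ⬝ᵥ vecQ v)) =
        c * ∑ k : PadicCosets p d n, padicExp (lam * (vecQ k.out ⬝ᵥ vecQ v)) := by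
      rw [Finset.mul_sum]
      refine Fintype.sum_equiv
        (Equiv.subRight ((Pi.single i 1 : Fin d → ℤ_[p]) : PadicCosets p d n)) _ _ fun k => ?_
      obtain ⟨u, rfl⟩ := QuotientAddGroup.mk_surjective k
      rw [Equiv.subRight_apply, ← QuotientAddGroup.mk_sub, padicExp_mul_dotProduct_out hlam.le,
        padicExp_mul_dotProduct_out hlam.le, hc, ← padicExp_add, vecQ_sub, sub_dotProduct]
      congr 1
      ring
    have h2 : (1 - c) * ∑ k : PadicCosets p d n, padicExp (lam * (vecQ k.out ⬝ᵥ vecQ v)) = 0 := by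
      rw [sub_mul, one_mul, ← h1, sub_self]
    exact (mul_eq_zero.1 h2).resolve_left (sub_ne_zero.2 (Ne.symm hc1))

/-- The fibres of a map to a finite set have equal measures `1 / |K|` once all their measures
agree. -/
theorem measureReal_fiber_eq_inv_card {Ω K : Type*} [MeasurableSpace Ω] [Fintype K]
    [MeasurableSpace K] [MeasurableSingletonClass K] (μ : Measure Ω) [IsProbabilityMeasure μ]
    {f : Ω → K} (hf : Measurable f) (k : K) (h : ∀ l, μ (f ⁻¹' {l}) = μ (f ⁻¹' {k})) :
    μ.real (f ⁻¹' {k}) = (Fintype.card K : ℝ)⁻¹ := by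
  have h1 := sum_measure_preimage_singleton (μ := μ) Finset.univ (f := f)
    (fun y _ => hf (measurableSet_singleton y))
  rw [Finset.sum_congr rfl (fun l _ => h l), Finset.sum_const, Finset.card_univ, Finset.coe_univ,
    Set.preimage_univ, measure_univ, nsmul_eq_mul] at h1
  refine eq_inv_of_mul_eq_one_right ?_
  rw [measureReal_def, ← ENNReal.toReal_natCast, ← ENNReal.toReal_mul, h1, ENNReal.toReal_one]

instance instIsProbabilityMeasureZpHaar : IsProbabilityMeasure (zpHaar p d) :=
  ⟨by rw [zpHaar]; exact Measure.addHaarMeasure_self (K₀ := ⊤)⟩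

instance instIsAddLeftInvariantZpHaar : (zpHaar p d).IsAddLeftInvariant := by
  unfold zpHaar; infer_instance

instance instIsProbabilityMeasureHeisHaar : IsProbabilityMeasure (heisHaar p d) :=
  ⟨by rw [heisHaar]; exact Measure.haarMeasure_self (K₀ := ⊤)⟩

instance instIsMulLeftInvariantHeisHaar : (heisHaar p d).IsMulLeftInvariant := by
  unfold heisHaar; infer_instance

instance instIsHaarMeasureHeisHaar : (heisHaar p d).IsHaarMeasure := by
  unfold heisHaar; infer_instance

theorem zpHaar_real_coset (n : ℕ) (k : PadicCosets p d n) :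
    (zpHaar p d).real {u : Fin d → ℤ_[p] | (u : PadicCosets p d n) = k} =
      (((p : ℝ) ^ n) ^ d)⁻¹ := by
  let _ : MeasurableSpace (PadicCosets p d n) := ⊤
  have h := measureReal_fiber_eq_inv_card (zpHaar p d)
    (f := fun u : Fin d → ℤ_[p] => (u : PadicCosets p d n))
    (measurable_to_countable' fun l => measurableSet_padicCoset p d n l) k (fun l => by
      rw [← measure_preimage_add (zpHaar p d) (l.out - k.out)]
      congr 1
      ext u
      simp only [Set.mem_preimage, Set.mem_singleton_iff, QuotientAddGroup.mk_add,
        QuotientAddGroup.mk_sub, mk_out_padicCoset]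
      rw [sub_add_eq_add_sub, sub_eq_iff_eq_add, add_right_inj])
  rw [card_padicCosets] at h
  push_cast at h
  exact h

theorem heisHaar_real_coset (n : ℕ) (k : PadicCosets p d n) :
    (heisHaar p d).real {g : Heis p d | (g.x : PadicCosets p d n) = k} =
      (((p : ℝ) ^ n) ^ d)⁻¹ := by
  let _ : MeasurableSpace (PadicCosets p d n) := ⊤
  have h := measureReal_fiber_eq_inv_card (heisHaar p d)
    (f := fun g : Heis p d => (g.x : PadicCosets p d n))
    (measurable_to_countable' fun l => (((isOpen_discrete {l}).preimage
      QuotientAddGroup.continuous_mk).preimage Heis.continuous_x).measurableSet) k (fun l => by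
      rw [← measure_preimage_mul (heisHaar p d) ⟨l.out - k.out, 0, 0⟩]
      congr 1
      ext g
      change ((l.out - k.out + g.x : Fin d → ℤ_[p]) : PadicCosets p d n) = l ↔ _ = _
      simp only [QuotientAddGroup.mk_add, QuotientAddGroup.mk_sub, mk_out_padicCoset]
      rw [sub_add_eq_add_sub, sub_eq_iff_eq_add, add_right_inj])
  rw [card_padicCosets] at h
  push_cast at h
  exact h

end Cosets

/-! ### The space `ℋ_λ` -/

section Space

variable {p d : ℕ} [Fact p.Prime]

theorem orthonormal_phiH {lam : ℚ_[p]} (hlam : lam ∈ padicReps p 0) :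
    Orthonormal ℂ (phiH d lam) := by
  classical
  rw [orthonormal_iff_ite]
  intro h h'
  rw [Submodule.coe_inner]
  change inner ℂ (phi d lam h) (phi d lam h') = _
  rw [phi, phi, L2.inner_indicatorConstLp_indicatorConstLp]
  split_ifs with hh
  · subst hh
    have hpos := norm_pos_of_mem_padicReps hlam
    rw [Set.inter_self, zpHaar_real_coset, ← norm_eq_pow_padicLevel hlam]
    -- `|λ|_p^{d/2} |λ|_p^{d/2}` cancels against the measure `|λ|_p^{-d}` of a coset.
    simp only [RCLike.inner_apply, Complex.conj_ofReal]
    rw [← Complex.ofReal_mul, ← Real.rpow_add hpos, add_halves, Real.rpow_natCast]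
    rw [Complex.real_smul, ← Complex.ofReal_mul, inv_mul_cancel₀ (pow_pos hpos _).ne',
      Complex.ofReal_one]
  · have : {u : Fin d → ℤ_[p] | (u : PadicCosets p d (padicLevel lam)) = h} ∩
        {u | (u : PadicCosets p d (padicLevel lam)) = h'} = ∅ := by
      ext u
      simp only [Set.mem_inter_iff, Set.mem_ofPred_eq, Set.mem_empty_iff_false, iff_false]
      rintro ⟨rfl, h2⟩
      exact hh h2
    rw [this]
    simp

theorem span_phiH (lam : ℚ_[p]) : Submodule.span ℂ (Set.range (phiH d lam)) = ⊤ := by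
  rw [eq_top_iff]
  rintro ⟨v, hv⟩ -
  have h1 := Submodule.map_span (HLam d lam).subtype (Set.range (phiH d lam))
  have h2 : (HLam d lam).subtype '' Set.range (phiH d lam) = Set.range (phi d lam) := by
    rw [← Set.range_comp]; rfl
  rw [h2] at h1
  have h3 : v ∈ Submodule.map (HLam d lam).subtype (Submodule.span ℂ (Set.range (phiH d lam))) := by
    rw [h1]; exact hv
  obtain ⟨w, hw, hwv⟩ := Submodule.mem_map.1 h3
  have : w = ⟨v, hv⟩ := Subtype.ext hwv
  rwa [← this]

/-- The orthonormal basis `φ_h` of `ℋ_λ`. -/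
noncomputable def phiBasis (d : ℕ) {lam : ℚ_[p]} (hlam : lam ∈ padicReps p 0) :
    OrthonormalBasis (PadicCosets p d (padicLevel lam)) ℂ (HLam d lam) :=
  OrthonormalBasis.mk (orthonormal_phiH hlam) (span_phiH lam).ge

theorem phiBasis_apply {lam : ℚ_[p]} (hlam : lam ∈ padicReps p 0)
    (h : PadicCosets p d (padicLevel lam)) : phiBasis d hlam h = phiH d lam h := by
  simp [phiBasis]

theorem finrank_HLam {lam : ℚ_[p]} (hlam : lam ∈ padicReps p 0) :
    (Module.finrank ℂ (HLam d lam) : ℝ) = ‖lam‖ ^ d := by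
  rw [Module.finrank_eq_card_basis (phiBasis d hlam).toBasis, card_padicCosets,
    norm_eq_pow_padicLevel hlam]
  push_cast
  rfl

/-- An element of `ℋ_λ`, as a function, has the values `|λ|_p^{d/2}` times its coordinates in the
basis `φ_h`. -/
theorem coeFn_HLam {lam : ℚ_[p]} (hlam : lam ∈ padicReps p 0) (φ : HLam d lam) :
    ((φ : L2Zp p d) : (Fin d → ℤ_[p]) → ℂ) =ᵐ[zpHaar p d] fun u =>
      ((‖lam‖ ^ ((d : ℝ) / 2) : ℝ) : ℂ) *
        (phiBasis d hlam).repr φ (u : PadicCosets p d (padicLevel lam)) := by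
  classical
  have h1 : (φ : L2Zp p d) = ∑ k, (phiBasis d hlam).repr φ k • phi d lam k := by
    conv_lhs => rw [← (phiBasis d hlam).sum_repr φ]
    rw [Submodule.coe_sum]
    refine Finset.sum_congr rfl fun k _ => ?_
    rw [Submodule.coe_smul, phiBasis_apply]
    rfl
  have h2 : ∀ k, ((phi d lam k : L2Zp p d) : (Fin d → ℤ_[p]) → ℂ) =ᵐ[zpHaar p d]
      fun u => if (u : PadicCosets p d (padicLevel lam)) = k then
        ((‖lam‖ ^ ((d : ℝ) / 2) : ℝ) : ℂ) else 0 := fun k => by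
    refine (indicatorConstLp_coeFn (p := 2)).trans (Filter.Eventually.of_forall fun u => ?_)
    simp [Set.indicator_apply]
  have h3 : ∀ k, (((phiBasis d hlam).repr φ k • phi d lam k : L2Zp p d) :
      (Fin d → ℤ_[p]) → ℂ) =ᵐ[zpHaar p d] (phiBasis d hlam).repr φ k • ⇑(phi d lam k) :=
    fun k => Lp.coeFn_smul _ _
  rw [h1]
  refine (Lp.coeFn_finsetSum _ _).trans ?_
  filter_upwards [ae_all_iff.2 h2, ae_all_iff.2 h3] with u hu2 hu3
  rw [Finset.sum_apply, Finset.sum_congr rfl (fun k _ => hu3 k)]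
  simp only [Pi.smul_apply, hu2, smul_eq_mul, mul_ite, mul_zero, Finset.sum_ite_eq, Finset.mem_univ,
    if_true]
  ring

end Space

/-! ### The representations -/

section Representation

variable {p d : ℕ} [Fact p.Prime]

/-- The factor `e^{2 π i {ξ · x + η · y + λ (z + k · y)}_p}`, for a coset `k` of
`p^{-ϑ(λ)} ℤ_p^d`. -/
noncomputable def heisPhase (t : HeisParam p d) (g : Heis p d) (k : t.Idx) : ℂ :=
  padicExp (t.ξ ⬝ᵥ vecQ g.x + t.η ⬝ᵥ vecQ g.y + t.lam * ((g.z : ℚ_[p]) + vecQ k.out ⬝ᵥ vecQ g.y))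

theorem heisPhase_mk (t : HeisParam p d) (g : Heis p d) (u : Fin d → ℤ_[p]) :
    heisPhase t g (u : t.Idx) = padicExp (t.ξ ⬝ᵥ vecQ g.x + t.η ⬝ᵥ vecQ g.y +
      t.lam * ((g.z : ℚ_[p]) + vecQ u ⬝ᵥ vecQ g.y)) := by
  rw [heisPhase, mul_add, mul_add, ← add_assoc, ← add_assoc, padicExp_add,
    padicExp_mul_dotProduct_out (norm_eq_pow_padicLevel t.lam_mem).le, ← padicExp_add]

theorem norm_heisPhase (t : HeisParam p d) (g : Heis p d) (k : t.Idx) : ‖heisPhase t g k‖ = 1 :=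
  norm_padicExp _

theorem heis_mul_x (g g' : Heis p d) : (g * g').x = g.x + g'.x := rfl
theorem heis_mul_y (g g' : Heis p d) : (g * g').y = g.y + g'.y := rfl
theorem heis_mul_z (g g' : Heis p d) : (g * g').z = g.z + g'.z + g.x ⬝ᵥ g'.y := rfl
theorem heis_one_x : (1 : Heis p d).x = 0 := rfl
theorem heis_one_y : (1 : Heis p d).y = 0 := rfl
theorem heis_one_z : (1 : Heis p d).z = 0 := rfl

/-- The cocycle identity for the phases; the term `x · y'` of the group law is what makes it hold. -/
theorem heisPhase_mul (t : HeisParam p d) (g g' : Heis p d) (k : t.Idx) :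
    heisPhase t (g * g') k = heisPhase t g k * heisPhase t g' (k + (g.x : t.Idx)) := by
  obtain ⟨u, rfl⟩ := QuotientAddGroup.mk_surjective k
  rw [← QuotientAddGroup.mk_add, heisPhase_mk, heisPhase_mk, heisPhase_mk, ← padicExp_add,
    heis_mul_x, heis_mul_y, heis_mul_z, vecQ_add, vecQ_add, vecQ_add, PadicInt.coe_add,
    PadicInt.coe_add, ← vecQ_dotProduct]
  simp only [dotProduct_add, add_dotProduct]
  congr 1
  ring

theorem heisPhase_one (t : HeisParam p d) (k : t.Idx) : heisPhase t 1 k = 1 := by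
  rw [heisPhase, heis_one_x, heis_one_y, heis_one_z, vecQ_zero]
  simp [padicExp_zero]

/-- The operators of the representation in the coordinates given by the basis `φ_h`. -/
noncomputable def coordOp (t : HeisParam p d) (g : Heis p d) :
    EuclideanSpace ℂ t.Idx →ₗ[ℂ] EuclideanSpace ℂ t.Idx where
  toFun f := WithLp.toLp 2 fun k => heisPhase t g k * f (k + (g.x : t.Idx))
  map_add' f f' := by
    ext k
    simp [mul_add]
  map_smul' c f := by
    ext k
    simp [mul_left_comm]

theorem coordOp_apply (t : HeisParam p d) (g : Heis p d) (f : EuclideanSpace ℂ t.Idx)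
    (k : t.Idx) : coordOp t g f k = heisPhase t g k * f (k + (g.x : t.Idx)) := rfl

theorem coordOp_mul (t : HeisParam p d) (g g' : Heis p d) (f : EuclideanSpace ℂ t.Idx) :
    coordOp t (g * g') f = coordOp t g (coordOp t g' f) := by
  ext k
  rw [coordOp_apply, coordOp_apply, coordOp_apply, heisPhase_mul, heis_mul_x,
    QuotientAddGroup.mk_add, mul_assoc, add_assoc]

theorem coordOp_one (t : HeisParam p d) (f : EuclideanSpace ℂ t.Idx) : coordOp t 1 f = f := by
  ext k
  rw [coordOp_apply, heisPhase_one, heis_one_x, QuotientAddGroup.mk_zero, add_zero, one_mul]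

theorem norm_coordOp (t : HeisParam p d) (g : Heis p d) (f : EuclideanSpace ℂ t.Idx) :
    ‖coordOp t g f‖ = ‖f‖ := by
  rw [EuclideanSpace.norm_eq, EuclideanSpace.norm_eq]
  congr 1
  simp only [coordOp_apply, norm_mul, norm_heisPhase, one_mul]
  exact Fintype.sum_equiv (Equiv.addRight (g.x : t.Idx)) _ _ fun _ => rfl

/-- The representation in the coordinates given by the basis `φ_h`. -/
noncomputable def coordHom (t : HeisParam p d) :
    Heis p d →* (EuclideanSpace ℂ t.Idx ≃ₗᵢ[ℂ] EuclideanSpace ℂ t.Idx) where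
  toFun g :=
    { coordOp t g with
      invFun := coordOp t g⁻¹
      left_inv := fun f => by
        change coordOp t g⁻¹ (coordOp t g f) = f
        rw [← coordOp_mul, inv_mul_cancel, coordOp_one]
      right_inv := fun f => by
        change coordOp t g (coordOp t g⁻¹ f) = f
        rw [← coordOp_mul, mul_inv_cancel, coordOp_one]
      norm_map' := norm_coordOp t g }
  map_one' := by ext1 f; exact coordOp_one t f
  map_mul' g g' := by ext1 f; exact coordOp_mul t g g' f

theorem coordHom_apply (t : HeisParam p d) (g : Heis p d) (f : EuclideanSpace ℂ t.Idx)
    (k : t.Idx) : coordHom t g f k = heisPhase t g k * f (k + (g.x : t.Idx)) := rfl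

theorem continuous_vecQ : Continuous (vecQ : (Fin d → ℤ_[p]) → Fin d → ℚ_[p]) :=
  continuous_pi fun i => continuous_subtype_val.comp (continuous_apply i)

theorem continuous_heisPhase (t : HeisParam p d) (k : t.Idx) :
    Continuous fun g => heisPhase t g k := by
  have hx := continuous_vecQ.comp (Heis.continuous_x (p := p) (d := d))
  have hy := continuous_vecQ.comp (Heis.continuous_y (p := p) (d := d))
  have hz := continuous_subtype_val.comp (Heis.continuous_z (p := p) (d := d))
  refine continuous_padicExp.comp (((continuous_const.dotProduct hx).add
    (continuous_const.dotProduct hy)).add (continuous_const.mul (hz.add ?_)))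
  exact continuous_const.dotProduct hy

theorem continuous_coordHom (t : HeisParam p d) (f : EuclideanSpace ℂ t.Idx) :
    Continuous fun g => coordHom t g f := by
  refine (PiLp.continuous_toLp 2 _).comp (continuous_pi fun k => ?_)
  refine (continuous_heisPhase t k).mul ?_
  have h1 : Continuous fun g : Heis p d => k + (g.x : t.Idx) :=
    continuous_const.add (QuotientAddGroup.continuous_mk.comp Heis.continuous_x)
  exact (continuous_of_discreteTopology (f := fun l : t.Idx => f l)).comp h1

/-- The representation `π_{(ξ, η, λ)}` on `ℋ_λ`. -/
noncomputable def heisRep (t : HeisParam p d) : UnitaryRep (Heis p d) (HLam d t.lam) where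
  toHom :=
    { toFun g := ((phiBasis d t.lam_mem).repr.trans (coordHom t g)).trans
        (phiBasis d t.lam_mem).repr.symm
      map_one' := by ext1 v; simp
      map_mul' g g' := by ext1 v; simp }
  continuous_apply v :=
    (phiBasis d t.lam_mem).repr.symm.continuous.comp (continuous_coordHom t _)

theorem repr_heisRep (t : HeisParam p d) (g : Heis p d) (v : HLam d t.lam) (k : t.Idx) :
    (phiBasis d t.lam_mem).repr ((heisRep t).toHom g v) k =
      heisPhase t g k * (phiBasis d t.lam_mem).repr v (k + (g.x : t.Idx)) := by
  rw [← coordHom_apply]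
  simp [heisRep]

theorem actsByFormula_heisRep (t : HeisParam p d) : ActsByFormula t (heisRep t) := by
  intro g φ
  have h1 := coeFn_HLam t.lam_mem φ
  -- Translation by `g.x` maps null sets to null sets, so `coeFn_HLam` may be used at `u + g.x`.
  have h2 := (measurePreserving_add_right (zpHaar p d) g.x).quasiMeasurePreserving.ae_eq_comp h1
  filter_upwards [coeFn_HLam t.lam_mem ((heisRep t).toHom g φ), h2] with u hu1 hu2
  simp only [Function.comp_apply] at hu2
  rw [hu1, hu2, repr_heisRep, heisPhase_mk, QuotientAddGroup.mk_add]
  ring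

/-- `π(g) φ_h` is a multiple of `φ_{h - x}`. -/
theorem heisRep_phiH (t : HeisParam p d) (g : Heis p d) (h : t.Idx) :
    (heisRep t).toHom g (phiH d t.lam h) =
      heisPhase t g (h - (g.x : t.Idx)) • phiH d t.lam (h - (g.x : t.Idx)) := by
  classical
  apply (phiBasis d t.lam_mem).repr.injective
  ext k
  rw [repr_heisRep, map_smul, ← phiBasis_apply t.lam_mem, ← phiBasis_apply t.lam_mem,
    OrthonormalBasis.repr_self, OrthonormalBasis.repr_self]
  simp only [PiLp.smul_apply, smul_eq_mul, PiLp.single_apply]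
  by_cases hk : k = h - (g.x : t.Idx)
  · subst hk; simp
  · rw [if_neg hk, if_neg (fun h' => hk (by rw [← h']; abel)), mul_zero, mul_zero]

theorem matCoeff_heisRep (t : HeisParam p d) (h h' : t.Idx) (g : Heis p d) :
    matCoeff (heisRep t) h h' g =
      heisPhase t g h' * (open Classical in if (g.x : t.Idx) = h - h' then 1 else 0) := by
  classical
  rw [matCoeff, ← phiBasis_apply t.lam_mem, ← OrthonormalBasis.repr_apply_apply, repr_heisRep,
    ← phiBasis_apply t.lam_mem, OrthonormalBasis.repr_self, PiLp.single_apply]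
  simp only [eq_sub_iff_add_eq, add_comm h']

theorem matCoeff_heisRep_mk (t : HeisParam p d) (h h' : Fin d → ℤ_[p]) (g : Heis p d) :
    matCoeff (heisRep t) (h : t.Idx) (h' : t.Idx) g =
      padicExp (t.ξ ⬝ᵥ vecQ g.x + t.η ⬝ᵥ vecQ g.y
        + t.lam * ((g.z : ℚ_[p]) + vecQ h' ⬝ᵥ vecQ g.y)) *
      Set.indicator {x | x - (h - h') ∈ padicBall p d (padicLevel t.lam)} 1 g.x := by
  classical
  rw [matCoeff_heisRep, heisPhase_mk, ← QuotientAddGroup.mk_sub, Set.indicator_apply]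
  simp only [padicCoset_eq_iff, Set.mem_ofPred_eq, Pi.one_apply]

/-- Only `h = h'` contributes to the trace: this forces `x` into `p^{-ϑ(λ)} ℤ_p^d`, and the sum of
the phases over `h` does the same for `y`. -/
theorem repCharacter_heisRep (t : HeisParam p d) (g : Heis p d) :
    repCharacter (heisRep t) g =
      ((‖t.lam‖ ^ d : ℝ) : ℂ) *
      padicExp (t.ξ ⬝ᵥ vecQ g.x + t.η ⬝ᵥ vecQ g.y + t.lam * (g.z : ℚ_[p])) *
      Set.indicator (padicBall p d (padicLevel t.lam) : Set (Fin d → ℤ_[p])) 1 g.x *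
      Set.indicator (padicBall p d (padicLevel t.lam) : Set (Fin d → ℤ_[p])) 1 g.y := by
  classical
  have hx : ((g.x : t.Idx) = 0) ↔ g.x ∈ padicBall p d (padicLevel t.lam) :=
    QuotientAddGroup.eq_zero_iff _
  rw [repCharacter, LinearMap.trace_eq_sum_inner _ (phiBasis d t.lam_mem)]
  have h1 : ∀ k : t.Idx, inner ℂ (phiBasis d t.lam_mem k)
      (((heisRep t).toHom g).toLinearEquiv.toLinearMap (phiBasis d t.lam_mem k)) =
      padicExp (t.ξ ⬝ᵥ vecQ g.x + t.η ⬝ᵥ vecQ g.y + t.lam * (g.z : ℚ_[p])) *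
      Set.indicator (padicBall p d (padicLevel t.lam) : Set (Fin d → ℤ_[p])) 1 g.x *
        padicExp (t.lam * (vecQ k.out ⬝ᵥ vecQ g.y)) := fun k => by
    rw [phiBasis_apply]
    refine (matCoeff_heisRep t k k g).trans ?_
    rw [heisPhase, sub_self, Set.indicator_apply, mul_add t.lam, ← add_assoc, padicExp_add]
    simp only [hx, SetLike.mem_coe, Pi.one_apply]
    ring
  rw [Finset.sum_congr rfl fun k _ => h1 k, ← Finset.mul_sum,
    sum_padicExp_mul_dotProduct (norm_eq_pow_padicLevel t.lam_mem), norm_eq_pow_padicLevel t.lam_mem]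
  ring

end Representation

/-! ### Irreducibility and inequivalence -/

section Irreducible

variable {p d : ℕ} [Fact p.Prime]

theorem heisPhase_mul_conj_of_x_eq_zero (t : HeisParam p d) (j k l : t.Idx) :
    heisPhase t ⟨0, l.out, 0⟩ j * (starRingEnd ℂ) (heisPhase t ⟨0, l.out, 0⟩ k) =
      padicExp (t.lam * (vecQ l.out ⬝ᵥ vecQ (j.out - k.out))) := by
  rw [heisPhase, heisPhase, conj_padicExp, ← padicExp_add]
  congr 1
  rw [dotProduct_comm (vecQ l.out), vecQ_sub, sub_dotProduct]
  ring

/-- The average of the operators `π(0, y, 0)` against a character of `y` is the projection onto the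
line of `φ_k`. -/
theorem sum_heisRep_eq_smul_phiH (t : HeisParam p d) (k : t.Idx) (w : HLam d t.lam) :
    ∑ l : t.Idx, (starRingEnd ℂ) (heisPhase t ⟨0, l.out, 0⟩ k) •
        (heisRep t).toHom ⟨0, l.out, 0⟩ w =
      (((‖t.lam‖ ^ d : ℝ) : ℂ) * (phiBasis d t.lam_mem).repr w k) • phiH d t.lam k := by
  classical
  apply (phiBasis d t.lam_mem).repr.injective
  ext j
  rw [map_smul, ← phiBasis_apply t.lam_mem, OrthonormalBasis.repr_self, map_sum]
  simp only [map_smul, WithLp.ofLp_sum, WithLp.ofLp_smul, Finset.sum_apply, Pi.smul_apply,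
    smul_eq_mul, repr_heisRep, PiLp.single_apply, QuotientAddGroup.mk_zero, add_zero]
  have h1 : ∀ l : t.Idx, (starRingEnd ℂ) (heisPhase t ⟨0, l.out, 0⟩ k) *
      (heisPhase t ⟨0, l.out, 0⟩ j * (phiBasis d t.lam_mem).repr w j) =
      padicExp (t.lam * (vecQ l.out ⬝ᵥ vecQ (j.out - k.out))) *
        (phiBasis d t.lam_mem).repr w j := fun l => by
    rw [← heisPhase_mul_conj_of_x_eq_zero]
    ring
  rw [Finset.sum_congr rfl fun l _ => h1 l, ← Finset.sum_mul,
    sum_padicExp_mul_dotProduct (norm_eq_pow_padicLevel t.lam_mem),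
    ← norm_eq_pow_padicLevel t.lam_mem, Set.indicator_apply]
  simp only [SetLike.mem_coe, ← padicCoset_eq_iff, mk_out_padicCoset, Pi.one_apply]
  by_cases hjk : j = k
  · subst hjk; simp
  · simp [hjk]

theorem isIrreducible_heisRep (t : HeisParam p d) : (heisRep t).IsIrreducible := by
  refine ⟨⟨phiH d t.lam 0, 0, (orthonormal_phiH t.lam_mem).ne_zero 0⟩, fun W _ hW => ?_⟩
  rw [or_iff_not_imp_left]
  intro hbot
  obtain ⟨w, hwW, hw0⟩ := W.ne_bot_iff.1 hbot
  obtain ⟨k, hk⟩ : ∃ k, (phiBasis d t.lam_mem).repr w k ≠ 0 := by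
    by_contra! h
    apply hw0
    apply (phiBasis d t.lam_mem).repr.injective
    ext j
    rw [h j, map_zero]
    rfl
  have hkW : phiH d t.lam k ∈ W := by
    have h1 : ∑ l : t.Idx, (starRingEnd ℂ) (heisPhase t ⟨0, l.out, 0⟩ k) •
        (heisRep t).toHom ⟨0, l.out, 0⟩ w ∈ W :=
      W.sum_mem fun l _ => W.smul_mem _ (hW _ _ hwW)
    rw [sum_heisRep_eq_smul_phiH] at h1
    refine (W.smul_mem_iff (mul_ne_zero ?_ hk)).1 h1
    exact Complex.ofReal_ne_zero.2 (pow_pos (norm_pos_of_mem_padicReps t.lam_mem) _).ne'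
  rw [eq_top_iff, ← span_phiH, Submodule.span_le]
  rintro _ ⟨h, rfl⟩
  have h2 := hW ⟨k.out - h.out, 0, 0⟩ _ hkW
  rw [heisRep_phiH] at h2
  have h3 : k - ((k.out - h.out : Fin d → ℤ_[p]) : t.Idx) = h := by
    rw [QuotientAddGroup.mk_sub, mk_out_padicCoset, mk_out_padicCoset]; abel
  rw [h3] at h2
  refine (W.smul_mem_iff ?_).1 h2
  rw [← norm_ne_zero_iff, norm_heisPhase]
  exact one_ne_zero

theorem repCharacter_eq_of_equivalent {lam lam' : ℚ_[p]} {π : UnitaryRep (Heis p d) (HLam d lam)}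
    {π' : UnitaryRep (Heis p d) (HLam d lam')} (h : π.Equivalent π') (g : Heis p d) :
    repCharacter π g = repCharacter π' g := by
  obtain ⟨U, hU⟩ := h
  rw [repCharacter, repCharacter, ← LinearMap.trace_conj' _ U.toLinearEquiv]
  congr 1
  ext1 v
  obtain ⟨w, rfl⟩ := U.surjective v
  rw [LinearEquiv.conj_apply_apply]
  change U (π.toHom g (U.symm (U w))) = π'.toHom g (U w)
  rw [U.symm_apply_apply, hU]

/-- Representatives modulo `p^{-n} ℤ_p` are determined by their characters of `p^n ℤ_p^d`. -/
theorem heisParam_coord_eq {n : ℕ} {a b : Fin d → ℚ_[p]} (ha : ∀ i, a i ∈ padicReps p n)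
    (hb : ∀ i, b i ∈ padicReps p n)
    (h : ∀ u ∈ padicBall p d n, padicExp (a ⬝ᵥ vecQ u) = padicExp (b ⬝ᵥ vecQ u)) : a = b := by
  have h1 := norm_le_pow_of_padicExp_eq_one (a := a - b) (n := n) fun u hu => by
    rw [sub_dotProduct, padicExp_eq_one_iff, ← padicExp_eq_iff]
    exact h u hu
  exact funext fun i => padicReps_unique (ha i) (hb i) (h1 i)

/-- The restrictions of the central character and of the characters of `p^{-ϑ(λ)} ℤ_p^{2d}`
determine the parameter. -/
theorem heisParam_eq_of_padicExp_eq {t t' : HeisParam p d}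
    (hlam : ∀ z : ℤ_[p], padicExp (t.lam * (z : ℚ_[p])) = padicExp (t'.lam * (z : ℚ_[p])))
    (hξ : ∀ u ∈ padicBall p d (padicLevel t.lam), t.lam = t'.lam →
      padicExp (t.ξ ⬝ᵥ vecQ u) = padicExp (t'.ξ ⬝ᵥ vecQ u))
    (hη : ∀ u ∈ padicBall p d (padicLevel t.lam), t.lam = t'.lam →
      padicExp (t.η ⬝ᵥ vecQ u) = padicExp (t'.η ⬝ᵥ vecQ u)) : t = t' := by
  have h1 : t.lam = t'.lam := by
    refine padicReps_unique t.lam_mem t'.lam_mem ?_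
    have := hlam 1
    rwa [PadicInt.coe_one, mul_one, mul_one, padicExp_eq_iff, ← pow_zero (p : ℝ)] at this
  refine HeisParam.ext ?_ ?_ h1
  · exact heisParam_coord_eq t.ξ_mem (fun i => by rw [h1]; exact t'.ξ_mem i) fun u hu => hξ u hu h1
  · exact heisParam_coord_eq t.η_mem (fun i => by rw [h1]; exact t'.η_mem i) fun u hu => hη u hu h1

theorem heisParam_eq_of_equivalent {t t' : HeisParam p d}
    (h : (heisRep t).Equivalent (heisRep t')) : t = t' := by
  have hχ := repCharacter_eq_of_equivalent h
  simp only [repCharacter_heisRep] at hχ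
  have h0 : ∀ n, (0 : Fin d → ℤ_[p]) ∈ (padicBall p d n : Set (Fin d → ℤ_[p])) :=
    fun n => zero_mem (padicBall p d n)
  have hd : ((‖t.lam‖ ^ d : ℝ) : ℂ) = ((‖t'.lam‖ ^ d : ℝ) : ℂ) := by
    have := hχ ⟨0, 0, 0⟩
    simpa [Set.indicator_of_mem (h0 _), vecQ_zero, padicExp_zero] using this
  have hd0 : ((‖t.lam‖ ^ d : ℝ) : ℂ) ≠ 0 :=
    Complex.ofReal_ne_zero.2 (pow_pos (norm_pos_of_mem_padicReps t.lam_mem) _).ne'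
  refine heisParam_eq_of_padicExp_eq (fun z => ?_) (fun u hu hlam => ?_) (fun u hu hlam => ?_)
  · have := hχ ⟨0, 0, z⟩
    rw [Set.indicator_of_mem (h0 _), Set.indicator_of_mem (h0 _), ← hd, vecQ_zero] at this
    simpa only [dotProduct_zero, zero_add, Pi.one_apply, mul_one, mul_right_inj' hd0] using this
  · have := hχ ⟨u, 0, 0⟩
    rw [Set.indicator_of_mem (h0 _), Set.indicator_of_mem (h0 _), Set.indicator_of_mem
      (SetLike.mem_coe.2 hu), Set.indicator_of_mem (by rw [← hlam]; exact hu), ← hd, vecQ_zero]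
      at this
    simpa only [dotProduct_zero, zero_add, add_zero, PadicInt.coe_zero, mul_zero, Pi.one_apply,
      mul_one, mul_right_inj' hd0] using this
  · have := hχ ⟨0, u, 0⟩
    rw [Set.indicator_of_mem (h0 _), Set.indicator_of_mem (h0 _), Set.indicator_of_mem
      (SetLike.mem_coe.2 hu), Set.indicator_of_mem (by rw [← hlam]; exact hu), ← hd, vecQ_zero]
      at this
    simpa only [dotProduct_zero, zero_add, add_zero, PadicInt.coe_zero, mul_zero, Pi.one_apply,
      mul_one, mul_right_inj' hd0] using this

end Irreducible

/-! ### Orthogonality of the matrix coefficients -/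

section Orthogonality

variable {p d : ℕ} [Fact p.Prime]

/-- Left translation by an element which fixes every coset multiplies the coefficient by a phase. -/
theorem matCoeff_heisRep_mul_left (t : HeisParam p d) (h h' : t.Idx) {g₀ : Heis p d}
    (hg₀ : g₀.x ∈ padicBall p d (padicLevel t.lam)) (g : Heis p d) :
    matCoeff (heisRep t) h h' (g₀ * g) = heisPhase t g₀ h' * matCoeff (heisRep t) h h' g := by
  have h0 : (g₀.x : t.Idx) = 0 := (QuotientAddGroup.eq_zero_iff _).2 hg₀
  rw [matCoeff_heisRep, matCoeff_heisRep, heisPhase_mul, heis_mul_x, QuotientAddGroup.mk_add, h0,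
    add_zero, zero_add, mul_assoc]

/-- A left translation does not change the inner product of two matrix coefficients, but multiplies
it by a quotient of phases. -/
theorem heisPhase_eq_of_integral_ne_zero {t t' : HeisParam p d} {h h' : t.Idx} {k k' : t'.Idx}
    (hI : ∫ g, matCoeff (heisRep t) h h' g * (starRingEnd ℂ) (matCoeff (heisRep t') k k' g)
      ∂(heisHaar p d) ≠ 0) {g₀ : Heis p d}
    (hg : g₀.x ∈ padicBall p d (padicLevel t.lam)) (hg' : g₀.x ∈ padicBall p d (padicLevel t'.lam)) :
    heisPhase t g₀ h' = heisPhase t' g₀ k' := by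
  have h1 := integral_mul_left_eq_self (μ := heisHaar p d) (fun g => matCoeff (heisRep t) h h' g *
    (starRingEnd ℂ) (matCoeff (heisRep t') k k' g)) g₀
  have h2 : ∀ g, matCoeff (heisRep t) h h' (g₀ * g) *
      (starRingEnd ℂ) (matCoeff (heisRep t') k k' (g₀ * g)) =
      (heisPhase t g₀ h' * (starRingEnd ℂ) (heisPhase t' g₀ k')) *
        (matCoeff (heisRep t) h h' g * (starRingEnd ℂ) (matCoeff (heisRep t') k k' g)) :=
    fun g => by
      rw [matCoeff_heisRep_mul_left t h h' hg, matCoeff_heisRep_mul_left t' k k' hg', map_mul]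
      ring
  simp only [h2] at h1
  rw [integral_const_mul] at h1
  have h3 := mul_right_cancel₀ hI (h1.trans (one_mul _).symm)
  rw [← Complex.inv_eq_conj (norm_heisPhase t' g₀ k')] at h3
  exact eq_of_div_eq_one (by rw [div_eq_mul_inv]; exact h3)

theorem padicExp_dotProduct_of_mem {t : HeisParam p d} {u v : Fin d → ℤ_[p]}
    (hu : u ∈ padicBall p d (padicLevel t.lam)) :
    padicExp (t.η ⬝ᵥ vecQ u + t.lam * (vecQ v ⬝ᵥ vecQ u)) = padicExp (t.η ⬝ᵥ vecQ u) := by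
  apply padicExp_add_of_norm_le_one
  rw [dotProduct_comm]
  exact norm_mul_dotProduct_le_one (norm_eq_pow_padicLevel t.lam_mem).le hu v

/-- Taking `g₀` in each of the three coordinate subgroups recovers `λ`, `ξ` and `η`. -/
theorem heisParam_eq_of_integral_ne_zero {t t' : HeisParam p d} {h h' : t.Idx} {k k' : t'.Idx}
    (hI : ∫ g, matCoeff (heisRep t) h h' g * (starRingEnd ℂ) (matCoeff (heisRep t') k k' g)
      ∂(heisHaar p d) ≠ 0) : t = t' := by
  have key : ∀ g₀ : Heis p d, g₀.x ∈ padicBall p d (padicLevel t.lam) →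
      g₀.x ∈ padicBall p d (padicLevel t'.lam) → heisPhase t g₀ h' = heisPhase t' g₀ k' :=
    fun g₀ => heisPhase_eq_of_integral_ne_zero hI
  simp only [heisPhase] at key
  refine heisParam_eq_of_padicExp_eq (fun z => ?_) (fun u hu hlam => ?_) (fun u hu hlam => ?_)
  · simpa only [vecQ_zero, dotProduct_zero, zero_add, add_zero] using
      key ⟨0, 0, z⟩ (zero_mem _) (zero_mem _)
  · simpa only [vecQ_zero, dotProduct_zero, zero_add, add_zero, PadicInt.coe_zero, mul_zero] using
      key ⟨u, 0, 0⟩ hu (by rw [← hlam]; exact hu)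
  · have := key ⟨0, u, 0⟩ (zero_mem _) (zero_mem _)
    simp only [vecQ_zero, dotProduct_zero, zero_add, PadicInt.coe_zero] at this
    rwa [padicExp_dotProduct_of_mem hu, padicExp_dotProduct_of_mem (by rw [← hlam]; exact hu)]
      at this

theorem idx_eq_of_integral_ne_zero {t : HeisParam p d} {h h' k k' : t.Idx}
    (hI : ∫ g, matCoeff (heisRep t) h h' g * (starRingEnd ℂ) (matCoeff (heisRep t) k k' g)
      ∂(heisHaar p d) ≠ 0) : h = k ∧ h' = k' := by
  classical
  -- For `g₀ = (0, e_i, 0)` the phases differ by `e^{2 π i {λ (h' - k')_i}_p}`.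
  have h2 : h' = k' := by
    rw [← mk_out_padicCoset h', ← mk_out_padicCoset k', padicCoset_eq_iff]
    intro i
    have h1 := heisPhase_eq_of_integral_ne_zero hI (g₀ := ⟨0, Pi.single i 1, 0⟩) (zero_mem _)
      (zero_mem _)
    rw [heisPhase, heisPhase, padicExp_eq_iff] at h1
    simp only [vecQ_single, dotProduct_single, PadicInt.coe_one, mul_one, PadicInt.coe_zero,
      zero_add, add_sub_add_left_eq_sub] at h1
    rw [← mul_sub, norm_mul, norm_eq_pow_padicLevel t.lam_mem] at h1
    rw [pow_dvd_iff_norm_le, Pi.sub_apply, PadicInt.coe_sub]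
    exact h1
  subst h2
  refine ⟨?_, rfl⟩
  by_contra hne
  apply hI
  have : ∀ g, matCoeff (heisRep t) h h' g * (starRingEnd ℂ) (matCoeff (heisRep t) k h' g) = 0 := by
    intro g
    rw [matCoeff_heisRep, matCoeff_heisRep]
    by_cases h1 : (g.x : t.Idx) = h - h'
    · rw [if_neg (c := (g.x : t.Idx) = k - h') fun h3 => hne (sub_left_injective (h1.symm.trans h3))]
      simp
    · rw [if_neg h1]; simp
  simp only [this, integral_zero]

theorem integral_matCoeff_mul_conj_self (t : HeisParam p d) (h h' : t.Idx) :
    ∫ g, matCoeff (heisRep t) h h' g * (starRingEnd ℂ) (matCoeff (heisRep t) h h' g)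
      ∂(heisHaar p d) = (((‖t.lam‖ ^ d)⁻¹ : ℝ) : ℂ) := by
  classical
  have h1 : ∀ g, matCoeff (heisRep t) h h' g * (starRingEnd ℂ) (matCoeff (heisRep t) h h' g) =
      Set.indicator {g : Heis p d | (g.x : t.Idx) = h - h'} 1 g := by
    intro g
    rw [matCoeff_heisRep, Set.indicator_apply]
    by_cases h1 : (g.x : t.Idx) = h - h'
    · rw [if_pos h1, if_pos (by exact h1), mul_one, heisPhase, padicExp_mul_conj, Pi.one_apply]
    · rw [if_neg h1, if_neg (by exact h1), mul_zero, zero_mul]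
  simp only [h1]
  have hm : MeasurableSet {g : Heis p d | (g.x : t.Idx) = h - h'} :=
    (((isOpen_discrete {h - h'}).preimage
      QuotientAddGroup.continuous_mk).preimage Heis.continuous_x).measurableSet
  rw [integral_indicator hm]
  simp only [Pi.one_apply]
  rw [setIntegral_const, heisHaar_real_coset, norm_eq_pow_padicLevel t.lam_mem, Complex.real_smul,
    mul_one]

theorem integral_normCoeff (n : ℕ) (i j : CoeffIdx p d n) :
    ∫ g, normCoeff heisRep n i g * (starRingEnd ℂ) (normCoeff heisRep n j g) ∂(heisHaar p d) =
      open Classical in if i = j then 1 else 0 := by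
  classical
  obtain ⟨⟨t, ht⟩, h, h'⟩ := i
  obtain ⟨⟨t', ht'⟩, k, k'⟩ := j
  have hI : ∫ g, normCoeff heisRep n ⟨⟨t, ht⟩, h, h'⟩ g *
      (starRingEnd ℂ) (normCoeff heisRep n ⟨⟨t', ht'⟩, k, k'⟩ g) ∂(heisHaar p d) =
      (((‖t.lam‖ ^ ((d : ℝ) / 2) * ‖t'.lam‖ ^ ((d : ℝ) / 2) : ℝ)) : ℂ) *
      ∫ g, matCoeff (heisRep t) h h' g * (starRingEnd ℂ) (matCoeff (heisRep t') k k' g)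
        ∂(heisHaar p d) := by
    rw [← integral_const_mul]
    congr 1
    ext g
    simp only [normCoeff, map_mul, Complex.conj_ofReal, Complex.ofReal_mul]
    ring
  rw [hI]
  split_ifs with hij
  · cases hij
    have hpos := norm_pos_of_mem_padicReps t.lam_mem
    rw [integral_matCoeff_mul_conj_self, ← Real.rpow_add hpos, add_halves, Real.rpow_natCast,
      ← Complex.ofReal_mul, mul_inv_cancel₀ (pow_pos hpos _).ne', Complex.ofReal_one]
  · refine mul_eq_zero_of_right _ (by_contra fun hne => hij ?_)
    obtain rfl := heisParam_eq_of_integral_ne_zero hne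
    obtain ⟨rfl, rfl⟩ := idx_eq_of_integral_ne_zero hne
    rfl

end Orthogonality

/-! ### Completeness of the matrix coefficients in `𝒟_n(ℍ_d)` -/

section Completeness

variable {p d : ℕ} [Fact p.Prime]

theorem padicBall_anti {m n : ℕ} (h : m ≤ n) : padicBall p d n ≤ padicBall p d m :=
  fun _ hu i => (pow_dvd_pow _ h).trans (hu i)

theorem padicLevel_le_of_size_le {t : HeisParam p d} {n : ℕ} (ht : t.size ≤ (p : ℝ) ^ n) :
    padicLevel t.lam ≤ n := by
  have h1 : ‖t.lam‖ ≤ (p : ℝ) ^ n := (le_max_right _ _).trans ht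
  rw [norm_eq_pow_padicLevel t.lam_mem] at h1
  exact (pow_le_pow_iff_right₀ one_lt_prime_cast).1 h1

theorem heisPhase_eq_one_of_mem_heisBall {t : HeisParam p d} {n : ℕ} (ht : t.size ≤ (p : ℝ) ^ n)
    {k : Heis p d} (hk : k ∈ heisBall p d n) (l : t.Idx) : heisPhase t k l = 1 := by
  have hξ : ∀ i, ‖t.ξ i‖ ≤ (p : ℝ) ^ n := fun i =>
    (norm_le_pi_norm _ i).trans (((le_max_left _ _).trans (le_max_left _ _)).trans ht)
  have hη : ∀ i, ‖t.η i‖ ≤ (p : ℝ) ^ n := fun i =>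
    (norm_le_pi_norm _ i).trans (((le_max_right _ _).trans (le_max_left _ _)).trans ht)
  have hlam : ‖t.lam‖ ≤ (p : ℝ) ^ n := (le_max_right _ _).trans ht
  obtain ⟨hx, hy, hz⟩ := hk
  have h1 : ‖t.lam * (k.z : ℚ_[p])‖ ≤ 1 := by
    rw [norm_mul]
    exact (mul_le_mul_of_nonneg_right hlam (norm_nonneg _)).trans (pow_dvd_iff_norm_le.1 hz)
  have h2 : ‖t.lam * (vecQ l.out ⬝ᵥ vecQ k.y)‖ ≤ 1 := by
    rw [dotProduct_comm]
    exact norm_mul_dotProduct_le_one hlam hy _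
  rw [heisPhase, mul_add, padicExp_add, padicExp_add, padicExp_add,
    padicExp_eq_one_iff.2 (norm_dotProduct_vecQ_le_one_of_mem hξ hx),
    padicExp_eq_one_iff.2 (norm_dotProduct_vecQ_le_one_of_mem hη hy),
    padicExp_eq_one_iff.2 h1, padicExp_eq_one_iff.2 h2]
  norm_num

theorem normCoeff_mem_smoothFun (n : ℕ) (j : CoeffIdx p d n) :
    normCoeff heisRep n j ∈ smoothFun p d n := by
  obtain ⟨⟨t, ht⟩, h, h'⟩ := j
  intro g k hk
  have hx : (k.x : t.Idx) = 0 :=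
    (QuotientAddGroup.eq_zero_iff _).2 (padicBall_anti (padicLevel_le_of_size_le ht) hk.1)
  simp only [normCoeff]
  rw [matCoeff_heisRep, matCoeff_heisRep, heisPhase_mul, heisPhase_eq_one_of_mem_heisBall ht hk,
    heis_mul_x, QuotientAddGroup.mk_add, hx, add_zero, mul_one]

/-- The function `e^{2 π i {a · x + b · y + c z}_p}` of the coordinates. -/
noncomputable def coordChar (a b : Fin d → ℚ_[p]) (c : ℚ_[p]) : Heis p d → ℂ := fun g =>
  padicExp (a ⬝ᵥ vecQ g.x + b ⬝ᵥ vecQ g.y + c * (g.z : ℚ_[p]))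

/-- The functions `coordChar a b c` with `‖(a, b, c)‖_p ≤ p^n`. -/
def coordChars (p d : ℕ) [Fact p.Prime] (n : ℕ) : Set (Heis p d → ℂ) :=
  {f | ∃ a b c, (∀ i, ‖a i‖ ≤ (p : ℝ) ^ n) ∧ (∀ i, ‖b i‖ ≤ (p : ℝ) ^ n) ∧ ‖c‖ ≤ (p : ℝ) ^ n ∧
    f = coordChar a b c}

theorem mul_mem_span_coordChars {n : ℕ} {f f' : Heis p d → ℂ}
    (hf : f ∈ Submodule.span ℂ (coordChars p d n))
    (hf' : f' ∈ Submodule.span ℂ (coordChars p d n)) :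
    f * f' ∈ Submodule.span ℂ (coordChars p d n) := by
  have h1 := Submodule.mul_mem_mul hf hf'
  rw [Submodule.span_mul_span] at h1
  refine Submodule.span_mono ?_ h1
  rintro _ ⟨_, ⟨a, b, c, ha, hb, hc, rfl⟩, _, ⟨a', b', c', ha', hb', hc', rfl⟩, rfl⟩
  refine ⟨a + a', b + b', c + c',
    fun i => (IsUltrametricDist.norm_add_le_max _ _).trans (max_le (ha i) (ha' i)),
    fun i => (IsUltrametricDist.norm_add_le_max _ _).trans (max_le (hb i) (hb' i)),
    (IsUltrametricDist.norm_add_le_max _ _).trans (max_le hc hc'), ?_⟩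
  ext g
  simp only [coordChar, Pi.mul_apply]
  rw [← padicExp_add, add_dotProduct, add_dotProduct]
  congr 1
  ring

/-- Fourier expansion of the indicator function of a coset of `p^n ℤ_p^e`, pulled back by
coordinates of the Heisenberg group. -/
theorem indicator_coset_mem_span {n e : ℕ} (q : Heis p d → Fin e → ℤ_[p])
    (hq : ∀ a : Fin e → ℚ_[p], (∀ i, ‖a i‖ ≤ (p : ℝ) ^ n) →
      (fun g => padicExp (a ⬝ᵥ vecQ (q g))) ∈ coordChars p d n) (k : PadicCosets p e n) :
    (fun g => open Classical in if (q g : PadicCosets p e n) = k then (1 : ℂ) else 0) ∈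
      Submodule.span ℂ (coordChars p d n) := by
  classical
  set lam : ℚ_[p] := ((p : ℚ_[p]) ^ n)⁻¹ with hlam
  have hn : ‖lam‖ = (p : ℝ) ^ n := norm_prime_pow_inv n
  have hc : (((p : ℝ) ^ n) ^ e : ℝ) ≠ 0 := (pow_pos (pow_pos prime_cast_pos _) _).ne'
  have h1 : (fun g => if (q g : PadicCosets p e n) = k then (1 : ℂ) else 0) =
      ∑ l : PadicCosets p e n, ((((((p : ℝ) ^ n) ^ e : ℝ) : ℂ))⁻¹ *
        padicExp (-(lam * (vecQ l.out ⬝ᵥ vecQ k.out)))) •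
          fun g => padicExp ((lam • vecQ l.out) ⬝ᵥ vecQ (q g)) := by
    ext g
    have h2 := sum_padicExp_mul_dotProduct hn (q g - k.out)
    rw [Set.indicator_apply] at h2
    simp only [SetLike.mem_coe, ← padicCoset_eq_iff, mk_out_padicCoset, Pi.one_apply] at h2
    rw [Finset.sum_apply, ← inv_mul_cancel_left₀ (Complex.ofReal_ne_zero.2 hc)
      (if (q g : PadicCosets p e n) = k then (1 : ℂ) else 0), ← h2, Finset.mul_sum]
    refine Finset.sum_congr rfl fun l _ => ?_
    rw [Pi.smul_apply, smul_eq_mul, mul_assoc, ← padicExp_add, vecQ_sub, dotProduct_sub,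
      smul_dotProduct, smul_eq_mul]
    congr 2
    ring
  rw [h1]
  refine Submodule.sum_mem _ fun l _ => Submodule.smul_mem _ _ (Submodule.subset_span (hq _ ?_))
  intro i
  rw [Pi.smul_apply, smul_eq_mul, norm_mul, hn]
  exact mul_le_of_le_one_right (pow_nonneg prime_cast_pos.le _) (PadicInt.norm_le_one _)

/-- A function in `𝒟_n(ℍ_d)` depends on the coordinates modulo `p^n` only, hence is a combination of
products of indicator functions of cosets in the three coordinates. -/
theorem smoothFun_le_span_coordChars (n : ℕ) :
    smoothFun p d n ≤ Submodule.span ℂ (coordChars p d n) := by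
  classical
  intro f hf
  -- The central coordinate, as a vector of length one.
  let q : Heis p d → Fin 1 → ℤ_[p] := fun g _ => g.z
  have h1 : f = ∑ a : PadicCosets p d n, ∑ b : PadicCosets p d n, ∑ c : PadicCosets p 1 n,
      f ⟨a.out, b.out, c.out 0⟩ •
        ((fun g : Heis p d => if (g.x : PadicCosets p d n) = a then (1 : ℂ) else 0) *
          (fun g : Heis p d => if (g.y : PadicCosets p d n) = b then (1 : ℂ) else 0) *
          (fun g : Heis p d => if (q g : PadicCosets p 1 n) = c then (1 : ℂ) else 0)) := by
    ext g
    simp only [Finset.sum_apply, Pi.smul_apply, Pi.mul_apply, smul_eq_mul, mul_ite, mul_one,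
      mul_zero, Finset.sum_ite_eq, Finset.mem_univ, if_true]
    -- `k` leads from `g` to the chosen representative of its class modulo `p^n`.
    set k := g⁻¹ * (⟨(g.x : PadicCosets p d n).out, (g.y : PadicCosets p d n).out,
      (q g : PadicCosets p 1 n).out 0⟩ : Heis p d) with hk
    have hx : k.x = (g.x : PadicCosets p d n).out - g.x := neg_add_eq_sub _ _
    have hy : k.y = (g.y : PadicCosets p d n).out - g.y := neg_add_eq_sub _ _
    have hz : k.z = ((q g : PadicCosets p 1 n).out - q g) 0 -
        g.x ⬝ᵥ ((g.y : PadicCosets p d n).out - g.y) := by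
      change -g.z + g.x ⬝ᵥ g.y + _ + (-g.x) ⬝ᵥ _ = _
      rw [neg_dotProduct, dotProduct_sub, Pi.sub_apply]
      change _ = _ - g.z - _
      ring
    rw [← hf g k ⟨?_, ?_, ?_⟩, hk, mul_inv_cancel_left]
    · rw [hx]; exact out_sub_mem_padicBall _
    · rw [hy]; exact out_sub_mem_padicBall _
    · rw [hz]
      refine dvd_sub (out_sub_mem_padicBall (q g) 0) ?_
      exact Finset.dvd_sum fun i _ => (out_sub_mem_padicBall g.y i).mul_left _
  rw [h1]
  refine Submodule.sum_mem _ fun a _ => Submodule.sum_mem _ fun b _ => Submodule.sum_mem _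
    fun c _ => Submodule.smul_mem _ _ (mul_mem_span_coordChars (mul_mem_span_coordChars ?_ ?_) ?_)
  · refine indicator_coset_mem_span (fun g => g.x) (fun u hu => ⟨u, 0, 0, hu, ?_, ?_, ?_⟩) a
    · simp
    · simp
    · ext g; simp [coordChar]
  · refine indicator_coset_mem_span (fun g => g.y) (fun u hu => ⟨0, u, 0, ?_, hu, ?_, ?_⟩) b
    · simp
    · simp
    · ext g; simp [coordChar]
  · refine indicator_coset_mem_span q (fun u hu => ⟨0, 0, u 0, ?_, ?_, hu 0, ?_⟩) c
    · simp
    · simp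
    · ext g; simp [coordChar, q, vecQ, dotProduct]

/-- Every parameter with coordinates in `p^{-n} ℤ_p` is congruent to a triple of
representatives. -/
theorem exists_heisParam (n : ℕ) (a b : Fin d → ℚ_[p]) (c : ℚ_[p]) (ha : ∀ i, ‖a i‖ ≤ (p : ℝ) ^ n)
    (hb : ∀ i, ‖b i‖ ≤ (p : ℝ) ^ n) (hc : ‖c‖ ≤ (p : ℝ) ^ n) :
    ∃ t : HeisParam p d, t.size ≤ (p : ℝ) ^ n ∧ ‖c - t.lam‖ ≤ 1 ∧
      (∀ i, ‖(a - t.ξ) i‖ ≤ (p : ℝ) ^ padicLevel t.lam) ∧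
      (∀ i, ‖(b - t.η) i‖ ≤ (p : ℝ) ^ padicLevel t.lam) := by
  obtain ⟨lam, hlam, h1, h2⟩ := exists_padicReps 0 n n.zero_le c hc
  have hm : padicLevel lam ≤ n := by
    rw [norm_eq_pow_padicLevel hlam] at h2
    exact (pow_le_pow_iff_right₀ one_lt_prime_cast).1 h2
  choose ξ hξ hξ1 hξ2 using fun i => exists_padicReps _ n hm (a i) (ha i)
  choose η hη hη1 hη2 using fun i => exists_padicReps _ n hm (b i) (hb i)
  have hpn : (0 : ℝ) ≤ (p : ℝ) ^ n := pow_nonneg prime_cast_pos.le _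
  refine ⟨⟨ξ, η, lam, hlam, hξ, hη⟩, ?_, by simpa using h1, hξ1, hη1⟩
  exact max_le (max_le ((pi_norm_le_iff_of_nonneg hpn).2 hξ2)
    ((pi_norm_le_iff_of_nonneg hpn).2 hη2)) h2

/-- The function `coordChar a b c` is a combination of the matrix coefficients with `h' = w`, where
`(ξ, η, λ)` represents `(a, b, c)` and `b - η = λ w`: on a coset of `p^{-ϑ(λ)} ℤ_p^d` the character
of `a - ξ` is constant. -/
theorem coordChar_mem_span_normCoeff (n : ℕ) (a b : Fin d → ℚ_[p]) (c : ℚ_[p])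
    (ha : ∀ i, ‖a i‖ ≤ (p : ℝ) ^ n) (hb : ∀ i, ‖b i‖ ≤ (p : ℝ) ^ n) (hc : ‖c‖ ≤ (p : ℝ) ^ n) :
    coordChar a b c ∈ Submodule.span ℂ (Set.range (normCoeff (p := p) (d := d) heisRep n)) := by
  classical
  obtain ⟨t, ht, hlam, hξ, hη⟩ := exists_heisParam n a b c ha hb hc
  have hpos := norm_pos_of_mem_padicReps t.lam_mem
  have hlam0 : t.lam ≠ 0 := norm_pos_iff.1 hpos
  -- `b - η` lies in `p^{ϑ(λ)} ℤ_p^d = λ ℤ_p^d`.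
  let w : Fin d → ℤ_[p] := fun i => ⟨t.lam⁻¹ * (b - t.η) i, by
    rw [norm_mul, norm_inv, inv_mul_le_iff₀ hpos, mul_one, norm_eq_pow_padicLevel t.lam_mem]
    exact hη i⟩
  have hw : t.lam • vecQ w = b - t.η := by
    ext i
    exact mul_inv_cancel_left₀ hlam0 _
  have hM : ∀ h h' : t.Idx, matCoeff (heisRep t) h h' ∈
      Submodule.span ℂ (Set.range (normCoeff (p := p) (d := d) heisRep n)) := fun h h' => by
    have h0 : ((‖t.lam‖ ^ ((d : ℝ) / 2) : ℝ) : ℂ) ≠ 0 :=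
      Complex.ofReal_ne_zero.2 (Real.rpow_pos_of_pos hpos _).ne'
    refine (Submodule.smul_mem_iff _ h0).1 (Submodule.subset_span ⟨⟨⟨t, ht⟩, h, h'⟩, ?_⟩)
    rfl
  have h1 : coordChar a b c = ∑ k : t.Idx, padicExp ((a - t.ξ) ⬝ᵥ vecQ k.out) •
      matCoeff (heisRep t) (k + (w : t.Idx)) (w : t.Idx) := by
    ext g
    simp only [Finset.sum_apply, Pi.smul_apply, smul_eq_mul, matCoeff_heisRep, add_sub_cancel_right,
      mul_ite, mul_one, mul_zero, Finset.sum_ite_eq, Finset.mem_univ, if_true]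
    rw [heisPhase_mk, ← padicExp_add, coordChar, padicExp_eq_iff]
    have h2 : a ⬝ᵥ vecQ g.x + b ⬝ᵥ vecQ g.y + c * (g.z : ℚ_[p]) -
        ((a - t.ξ) ⬝ᵥ vecQ (g.x : t.Idx).out + (t.ξ ⬝ᵥ vecQ g.x + t.η ⬝ᵥ vecQ g.y +
          t.lam * ((g.z : ℚ_[p]) + vecQ w ⬝ᵥ vecQ g.y))) =
        (c - t.lam) * (g.z : ℚ_[p]) + -((a - t.ξ) ⬝ᵥ vecQ ((g.x : t.Idx).out - g.x)) := by
      have h3 : t.lam * (vecQ w ⬝ᵥ vecQ g.y) = (b - t.η) ⬝ᵥ vecQ g.y := by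
        rw [← hw, smul_dotProduct, smul_eq_mul]
      rw [mul_add, h3, vecQ_sub]
      simp only [sub_dotProduct, dotProduct_sub]
      ring
    rw [h2]
    refine (IsUltrametricDist.norm_add_le_max _ _).trans (max_le ?_ ?_)
    · rw [norm_mul]
      exact mul_le_one₀ hlam (norm_nonneg _) (PadicInt.norm_le_one _)
    · rw [norm_neg]
      exact norm_dotProduct_vecQ_le_one_of_mem hξ (out_sub_mem_padicBall g.x)
  rw [h1]
  exact Submodule.sum_mem _ fun k _ => Submodule.smul_mem _ _ (hM _ _)

theorem span_normCoeff (n : ℕ) :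
    Submodule.span ℂ (Set.range (normCoeff (p := p) (d := d) heisRep n)) = smoothFun p d n := by
  refine le_antisymm (Submodule.span_le.2 ?_) ((smoothFun_le_span_coordChars n).trans
    (Submodule.span_le.2 ?_))
  · rintro _ ⟨j, rfl⟩
    exact normCoeff_mem_smoothFun n j
  · rintro _ ⟨a, b, c, ha, hb, hc, rfl⟩
    exact coordChar_mem_span_normCoeff n a b c ha hb hc

end Completeness

/-! ### Exhaustion of the unitary dual -/

section Schur

variable {G : Type*} [Group G] [TopologicalSpace G]
  {V : Type*} [NormedAddCommGroup V] [InnerProductSpace ℂ V] [FiniteDimensional ℂ V]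
  {H : Type*} [NormedAddCommGroup H] [InnerProductSpace ℂ H] [CompleteSpace H]

theorem toHom_mul_apply {W : Type*} [NormedAddCommGroup W] [InnerProductSpace ℂ W]
    (π : UnitaryRep G W) (g g' : G) (v : W) :
    π.toHom (g * g') v = π.toHom g (π.toHom g' v) := by
  rw [map_mul]; rfl

theorem toHom_one_apply {W : Type*} [NormedAddCommGroup W] [InnerProductSpace ℂ W]
    (π : UnitaryRep G W) (v : W) : π.toHom 1 v = v := by
  rw [map_one]; rfl

theorem inner_toHom_left {W : Type*} [NormedAddCommGroup W] [InnerProductSpace ℂ W]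
    (π : UnitaryRep G W) (g : G) (u v : W) :
    inner ℂ u (π.toHom g v) = inner ℂ (π.toHom g⁻¹ u) v := by
  have h1 : π.toHom g (π.toHom g⁻¹ u) = u := by
    rw [← toHom_mul_apply, mul_inv_cancel, toHom_one_apply]
  rw [← LinearIsometryEquiv.inner_map_map (π.toHom g) (π.toHom g⁻¹ u) v, h1]

/-- An intertwining operator on an irreducible representation of finite dimension scales norms by a
constant: `T† T` commutes with `π`, so its eigenspaces are invariant and it is a scalar. -/
theorem exists_norm_sq_map_eq_mul {π : UnitaryRep G V} (hπ : π.IsIrreducible)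
    {ρ : UnitaryRep G H} (T : V →ₗ[ℂ] H) (hT : ∀ g v, T (π.toHom g v) = ρ.toHom g (T v)) :
    ∃ c : ℝ, ∀ v, ‖T v‖ ^ 2 = c * ‖v‖ ^ 2 := by
  have : CompleteSpace V := FiniteDimensional.complete ℂ V
  obtain ⟨hnt, hsub⟩ := hπ
  let T' : V →L[ℂ] H := LinearMap.toContinuousLinearMap T
  let S : V →ₗ[ℂ] V := (ContinuousLinearMap.adjoint T' ∘L T' : V →L[ℂ] V)
  have hS : ∀ u v, inner ℂ u (S v) = inner ℂ (T u) (T v) := fun u v =>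
    ContinuousLinearMap.adjoint_inner_right T' u (T' v)
  have hcomm : ∀ g v, S (π.toHom g v) = π.toHom g (S v) := fun g v => by
    refine ext_inner_left ℂ fun u => ?_
    rw [hS, hT, inner_toHom_left ρ, ← hT, ← hS, ← inner_toHom_left π]
  obtain ⟨μ, hμ⟩ := Module.End.exists_eigenvalue S
  have htop : Module.End.eigenspace S μ = ⊤ := by
    refine (hsub _ (Submodule.closed_of_finiteDimensional _) fun g v hv => ?_).resolve_left hμ
    rw [Module.End.mem_eigenspace_iff] at hv ⊢
    rw [hcomm, hv, map_smul]
  refine ⟨μ.re, fun v => ?_⟩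
  have h1 : S v = μ • v := Module.End.mem_eigenspace_iff.1 (by rw [htop]; trivial)
  have h2 := hS v v
  rw [h1, inner_smul_right, inner_self_eq_norm_sq_to_K, inner_self_eq_norm_sq_to_K] at h2
  have h3 := congrArg Complex.re h2
  norm_cast at h3
  simpa [← Complex.ofReal_pow] using h3.symm

/-- A nonzero operator intertwining two irreducible representations, the first one of finite
dimension, is a multiple of a unitary equivalence. -/
theorem equivalent_of_intertwining {π : UnitaryRep G V} (hπ : π.IsIrreducible)
    {ρ : UnitaryRep G H} (hρ : ρ.IsIrreducible) (T : V →ₗ[ℂ] H) (hT0 : T ≠ 0)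
    (hT : ∀ g v, T (π.toHom g v) = ρ.toHom g (T v)) : ρ.Equivalent π := by
  obtain ⟨c, hc⟩ := exists_norm_sq_map_eq_mul hπ T hT
  obtain ⟨v₀, hv₀⟩ : ∃ v, T v ≠ 0 := by
    by_contra! h
    exact hT0 (LinearMap.ext h)
  have hc0 : 0 < c := by
    have h1 : 0 < c * ‖v₀‖ ^ 2 := by rw [← hc]; exact pow_pos (norm_pos_iff.2 hv₀) 2
    exact pos_of_mul_pos_left h1 (sq_nonneg _)
  have hrange : LinearMap.range T = ⊤ := by
    refine (hρ.2 _ (Submodule.closed_of_finiteDimensional _) ?_).resolve_left ?_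
    · rintro g _ ⟨v, rfl⟩
      exact ⟨π.toHom g v, hT g v⟩
    · exact fun h => hT0 (LinearMap.range_eq_bot.1 h)
  have hs : ((√c)⁻¹ : ℂ) ≠ 0 :=
    inv_ne_zero (Complex.ofReal_ne_zero.2 (Real.sqrt_pos.2 hc0).ne')
  let U : V →ₗᵢ[ℂ] H :=
    { ((√c)⁻¹ : ℂ) • T with
      norm_map' := fun v => by
        change ‖((√c)⁻¹ : ℂ) • T v‖ = ‖v‖
        have h1 : ‖T v‖ = √c * ‖v‖ := by
          rw [← Real.sqrt_sq (norm_nonneg (T v)), hc, Real.sqrt_mul hc0.le,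
            Real.sqrt_sq (norm_nonneg v)]
        rw [norm_smul, norm_inv, Complex.norm_real, Real.norm_of_nonneg (Real.sqrt_nonneg c), h1,
          inv_mul_cancel_left₀ (Real.sqrt_pos.2 hc0).ne'] }
  have hU : ∀ v, U v = ((√c)⁻¹ : ℂ) • T v := fun _ => rfl
  have hsurj : Function.Surjective U := fun y => by
    obtain ⟨v, hv⟩ := LinearMap.range_eq_top.1 hrange y
    refine ⟨((√c)⁻¹ : ℂ)⁻¹ • v, ?_⟩
    rw [hU, map_smul, hv, smul_smul, mul_inv_cancel₀ hs, one_smul]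
  let E := LinearIsometryEquiv.ofSurjective U hsurj
  have hE : ∀ g v, E (π.toHom g v) = ρ.toHom g (E v) := fun g v => by
    change U _ = ρ.toHom g (U v)
    rw [hU, hU, hT, map_smul]
  refine ⟨E.symm, fun g v => ?_⟩
  rw [LinearIsometryEquiv.symm_apply_eq, hE, LinearIsometryEquiv.apply_symm_apply]

end Schur

section Exhaustion

variable {p d : ℕ} [Fact p.Prime]

theorem exists_heisBall_subset {U : Set (Heis p d)} (hU : U ∈ nhds (1 : Heis p d)) :
    ∃ n, heisBall p d n ⊆ U := by
  have h1 : Heis.homeoProd.symm ⁻¹' U ∈ nhds (Heis.homeoProd (1 : Heis p d)) :=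
    Heis.homeoProd.symm.continuous.continuousAt.preimage_mem_nhds
      (by rwa [Homeomorph.symm_apply_apply])
  obtain ⟨ε, hε, hball⟩ := Metric.mem_nhds_iff.1 h1
  obtain ⟨n, hn⟩ := exists_pow_lt_of_lt_one hε (inv_lt_one_of_one_lt₀ (one_lt_prime_cast (p := p)))
  have hdvd : ∀ a : ℤ_[p], (p : ℤ_[p]) ^ n ∣ a → ‖a‖ < ε := fun a ha => by
    rw [← Ideal.mem_span_singleton, ← PadicInt.norm_le_pow_iff_mem_span_pow, zpow_neg,
      zpow_natCast, ← inv_pow] at ha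
    exact ha.trans_lt hn
  refine ⟨n, fun k hk => ?_⟩
  have h2 : Heis.homeoProd k ∈ Metric.ball (Heis.homeoProd (1 : Heis p d)) ε := by
    rw [Metric.mem_ball, Prod.dist_eq, Prod.dist_eq]
    refine max_lt ?_ (max_lt ?_ ?_)
    · change dist k.x 0 < ε
      rw [dist_zero_right]
      exact (pi_norm_lt_iff hε).2 fun i => hdvd _ (hk.1 i)
    · change dist k.y 0 < ε
      rw [dist_zero_right]
      exact (pi_norm_lt_iff hε).2 fun i => hdvd _ (hk.2.1 i)
    · change dist k.z 0 < ε
      rw [dist_zero_right]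
      exact hdvd _ hk.2.2
  have h3 := hball h2
  rwa [Set.mem_preimage, Homeomorph.symm_apply_apply] at h3

theorem mul_mem_heisBall {n : ℕ} {g k : Heis p d} (hg : g ∈ heisBall p d n)
    (hk : k ∈ heisBall p d n) : g * k ∈ heisBall p d n :=
  ⟨add_mem hg.1 hk.1, add_mem hg.2.1 hk.2.1,
    dvd_add (dvd_add hg.2.2 hk.2.2) (Finset.dvd_sum fun i _ => (hk.2.1 i).mul_left _)⟩

theorem inv_mem_heisBall {n : ℕ} {g : Heis p d} (hg : g ∈ heisBall p d n) :
    g⁻¹ ∈ heisBall p d n :=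
  ⟨neg_mem hg.1, neg_mem hg.2.1,
    dvd_add ((dvd_neg).2 hg.2.2) (Finset.dvd_sum fun i _ => (hg.2.1 i).mul_left _)⟩

theorem one_mem_heisBall (n : ℕ) : (1 : Heis p d) ∈ heisBall p d n :=
  ⟨zero_mem _, zero_mem _, dvd_zero _⟩

theorem indicator_heisBall_mem_smoothFun (n : ℕ) :
    Set.indicator (heisBall p d n) 1 ∈ smoothFun p d n := by
  classical
  intro g k hk
  have h1 : g * k ∈ heisBall p d n ↔ g ∈ heisBall p d n :=
    ⟨fun h => by simpa using mul_mem_heisBall h (inv_mem_heisBall hk),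
      fun h => mul_mem_heisBall h hk⟩
  simp only [Set.indicator_apply, h1, Pi.one_apply]

theorem integrable_of_continuous_heis {E : Type*} [NormedAddCommGroup E] {f : Heis p d → E}
    (hf : Continuous f) : Integrable f (heisHaar p d) :=
  hf.integrable_of_hasCompactSupport (HasCompactSupport.of_compactSpace f)

theorem continuous_matCoeff {lam : ℚ_[p]} (π : UnitaryRep (Heis p d) (HLam d lam))
    (h h' : PadicCosets p d (padicLevel lam)) : Continuous (matCoeff π h h') :=
  continuous_const.inner (π.continuous_apply _)

/-- Orthogonality to all matrix coefficients extends to their span `𝒟_n(ℍ_d)`; the continuity is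
carried along for the integrability. -/
theorem continuous_and_integral_eq_zero_of_mem_smoothFun {F : Heis p d → ℂ} (hF : Continuous F)
    (h0 : ∀ (t : HeisParam p d) (h h' : t.Idx),
      ∫ g, (starRingEnd ℂ) (matCoeff (heisRep t) h h' g) * F g ∂(heisHaar p d) = 0)
    {n : ℕ} {q : Heis p d → ℂ} (hq : q ∈ smoothFun p d n) :
    Continuous q ∧ ∫ g, (starRingEnd ℂ) (q g) * F g ∂(heisHaar p d) = 0 := by
  rw [← span_normCoeff] at hq
  induction hq using Submodule.span_induction with
  | mem q hq =>
    obtain ⟨⟨⟨t, ht⟩, h, h'⟩, rfl⟩ := hq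
    refine ⟨continuous_const.mul (continuous_matCoeff _ _ _), ?_⟩
    simp only [normCoeff, map_mul, mul_assoc]
    rw [integral_const_mul, h0, mul_zero]
  | zero => exact ⟨continuous_const, by simp⟩
  | add q r _ _ hq hr =>
    refine ⟨hq.1.add hr.1, ?_⟩
    simp only [Pi.add_apply, map_add, add_mul]
    refine (integral_add
      (integrable_of_continuous_heis ((Complex.continuous_conj.comp hq.1).mul hF))
      (integrable_of_continuous_heis ((Complex.continuous_conj.comp hr.1).mul hF))).trans ?_
    exact (congrArg₂ (· + ·) hq.2 hr.2).trans (add_zero 0)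
  | smul c q _ hq =>
    refine ⟨hq.1.const_smul c, ?_⟩
    simp only [Pi.smul_apply, smul_eq_mul, map_mul, mul_assoc]
    rw [integral_const_mul, hq.2, mul_zero]

/-- A continuous function which is positive at `1` is not orthogonal to all matrix coefficients:
its integral over a small subgroup `ℍ_d(p^n ℤ_p)` has positive real part. -/
theorem exists_integral_matCoeff_ne_zero {F : Heis p d → ℂ} (hF : Continuous F)
    (hF1 : 0 < (F 1).re) : ∃ (t : HeisParam p d) (h h' : t.Idx),
      ∫ g, (starRingEnd ℂ) (matCoeff (heisRep t) h h' g) * F g ∂(heisHaar p d) ≠ 0 := by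
  classical
  by_contra! h0
  have hre : Continuous fun g => (F g).re := Complex.continuous_re.comp hF
  obtain ⟨n, hn⟩ := exists_heisBall_subset (hre.continuousAt.preimage_mem_nhds
    (Ioi_mem_nhds hF1))
  obtain ⟨hc, hI⟩ := continuous_and_integral_eq_zero_of_mem_smoothFun hF h0
    (indicator_heisBall_mem_smoothFun n)
  have hcont : Continuous fun g =>
      (starRingEnd ℂ) (Set.indicator (heisBall p d n) 1 g) * F g :=
    (Complex.continuous_conj.comp hc).mul hF
  have h1 : ∫ g, ((starRingEnd ℂ) (Set.indicator (heisBall p d n) 1 g) * F g).re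
      ∂(heisHaar p d) = 0 := by
    have := integral_re (integrable_of_continuous_heis hcont)
    rw [hI] at this
    simpa using this
  refine (Continuous.integral_pos_of_hasCompactSupport_nonneg_nonzero
    (Complex.continuous_re.comp hcont) (HasCompactSupport.of_compactSpace _) (fun g => ?_)
    (x := 1) ?_).ne' h1
  · by_cases hg : g ∈ heisBall p d n
    · simpa [Set.indicator_of_mem hg] using (hn hg).le
    · simp [Set.indicator_of_notMem hg]
  · simpa [Set.indicator_of_mem (one_mem_heisBall n)] using hF1.ne'

variable {H : Type*} [NormedAddCommGroup H] [InnerProductSpace ℂ H]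

theorem continuous_average_integrand (ρ : UnitaryRep (Heis p d) H) {lam : ℚ_[p]}
    (π : UnitaryRep (Heis p d) (HLam d lam)) (v : H) (w x : HLam d lam) :
    Continuous fun g => inner ℂ (π.toHom g w) x • ρ.toHom g v :=
  ((π.continuous_apply w).inner continuous_const).smul (ρ.continuous_apply v)

variable [CompleteSpace H]

/-- The average `∫ ρ(g) A π(g)⁻¹ dg` over the Heisenberg group, where `A` is the operator
`x ↦ (x, w) v` of rank one. -/
noncomputable def averageOp (ρ : UnitaryRep (Heis p d) H) {lam : ℚ_[p]}
    (π : UnitaryRep (Heis p d) (HLam d lam)) (v : H) (w : HLam d lam) : HLam d lam →ₗ[ℂ] H where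
  toFun x := ∫ g, inner ℂ (π.toHom g w) x • ρ.toHom g v ∂(heisHaar p d)
  map_add' x y := by
    simp only [inner_add_right, add_smul]
    exact integral_add (integrable_of_continuous_heis (continuous_average_integrand ρ π v w x))
      (integrable_of_continuous_heis (continuous_average_integrand ρ π v w y))
  map_smul' c x := by
    simp only [inner_smul_right, mul_smul, RingHom.id_apply]
    exact integral_smul c _

theorem averageOp_intertwines (ρ : UnitaryRep (Heis p d) H) {lam : ℚ_[p]}
    (π : UnitaryRep (Heis p d) (HLam d lam)) (v : H) (w : HLam d lam) (g₀ : Heis p d)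
    (x : HLam d lam) : averageOp ρ π v w (π.toHom g₀ x) = ρ.toHom g₀ (averageOp ρ π v w x) := by
  change ∫ g, inner ℂ (π.toHom g w) (π.toHom g₀ x) • ρ.toHom g v ∂(heisHaar p d) =
    ρ.toHom g₀ (∫ g, inner ℂ (π.toHom g w) x • ρ.toHom g v ∂(heisHaar p d))
  rw [← integral_mul_left_eq_self _ g₀]
  simp only [toHom_mul_apply, LinearIsometryEquiv.inner_map_map]
  have h1 := ((ρ.toHom g₀).toContinuousLinearEquiv.toContinuousLinearMap).integral_comp_comm
    (integrable_of_continuous_heis (continuous_average_integrand ρ π v w x))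
  refine Eq.trans ?_ h1
  congr 1
  ext g
  exact (map_smul (ρ.toHom g₀) _ _).symm

/-- Every irreducible unitary representation is equivalent to some `π_{(ξ, η, λ)}`: the integrals
`∫ conj π_{h h'}(g) (v, ρ(g) v) dg` are inner products of `v` with values of intertwining
operators, and they cannot all vanish. -/
theorem exists_equivalent_heisRep (ρ : UnitaryRep (Heis p d) H) (hρ : ρ.IsIrreducible) :
    ∃ t, ρ.Equivalent (heisRep t) := by
  obtain ⟨v, hv⟩ := (@exists_ne _ hρ.1 (0 : H))
  have hF : Continuous fun g => inner ℂ v (ρ.toHom g v) :=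
    continuous_const.inner (ρ.continuous_apply v)
  obtain ⟨t, h, h', hne⟩ := exists_integral_matCoeff_ne_zero hF (by
    rw [toHom_one_apply]
    exact (pow_pos (norm_pos_iff.2 hv) 2).trans_eq (inner_self_eq_norm_sq (𝕜 := ℂ) v).symm)
  refine ⟨t, equivalent_of_intertwining (isIrreducible_heisRep t) hρ
    (averageOp ρ (heisRep t) v (phiH d t.lam h)) (fun hT => hne ?_)
    (averageOp_intertwines ρ (heisRep t) v _)⟩
  have h1 := integral_inner (𝕜 := ℂ) (integrable_of_continuous_heis
    (continuous_average_integrand ρ (heisRep t) v (phiH d t.lam h) (phiH d t.lam h'))) v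
  have h2 : ∫ g, inner ℂ ((heisRep t).toHom g (phiH d t.lam h)) (phiH d t.lam h') •
      ρ.toHom g v ∂(heisHaar p d) = 0 := LinearMap.congr_fun hT (phiH d t.lam h')
  rw [h2, inner_zero_right] at h1
  rw [← h1]
  congr 1
  ext g
  -- The `inner` in `matCoeff` is found through `CStarModule ℂ`; it is the usual one by definition.
  have h3 : (starRingEnd ℂ) (matCoeff (heisRep t) h h' g) =
      inner ℂ ((heisRep t).toHom g (phiH d t.lam h)) (phiH d t.lam h') :=
    inner_conj_symm (𝕜 := ℂ) (E := HLam d t.lam) ((heisRep t).toHom g (phiH d t.lam h))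
      (phiH d t.lam h')
  rw [inner_smul_right, h3]

end Exhaustion

/-! ### The classification -/

theorem theorem1 (p d : ℕ) [Fact p.Prime] (hp : 2 < p) :
    ∃ (π : ∀ t : HeisParam p d, UnitaryRep (Heis p d) (HLam d t.lam))
      (hirr : ∀ t, (π t).IsIrreducible),
      -- the action on `ℋ_λ`
      (∀ t, ActsByFormula t (π t)) ∧
      -- the parameters are in bijection with the unitary dual
      Function.Bijective (fun t : HeisParam p d =>
        (Quotient.mk _ ⟨HLam d t.lam, π t, hirr t⟩ : UnitaryDual (Heis p d))) ∧
      -- exhaustion, for Hilbert spaces in any universe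
      (∀ (H : Type*) [NormedAddCommGroup H] [InnerProductSpace ℂ H] [CompleteSpace H]
        (ρ : UnitaryRep (Heis p d) H), ρ.IsIrreducible → ∃! t, ρ.Equivalent (π t)) ∧
      -- dimension and basis of `ℋ_λ`
      (∀ t : HeisParam p d, (Module.finrank ℂ (HLam d t.lam) : ℝ) = ‖t.lam‖ ^ d ∧
        Orthonormal ℂ (phiH d t.lam) ∧
        Submodule.span ℂ (Set.range (phiH d t.lam)) = ⊤) ∧
      -- matrix coefficients
      (∀ (t : HeisParam p d) (h h' : Fin d → ℤ_[p]) (g : Heis p d),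
        matCoeff (π t) (h : t.Idx) (h' : t.Idx) g =
          padicExp (t.ξ ⬝ᵥ vecQ g.x + t.η ⬝ᵥ vecQ g.y
            + t.lam * ((g.z : ℚ_[p]) + vecQ h' ⬝ᵥ vecQ g.y)) *
          Set.indicator {x | x - (h - h') ∈ padicBall p d (padicLevel t.lam)} 1 g.x) ∧
      -- characters
      (∀ (t : HeisParam p d) (g : Heis p d),
        repCharacter (π t) g =
          ((‖t.lam‖ ^ d : ℝ) : ℂ) *
          padicExp (t.ξ ⬝ᵥ vecQ g.x + t.η ⬝ᵥ vecQ g.y + t.lam * (g.z : ℚ_[p])) *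
          Set.indicator (padicBall p d (padicLevel t.lam) : Set (Fin d → ℤ_[p])) 1 g.x *
          Set.indicator (padicBall p d (padicLevel t.lam) : Set (Fin d → ℤ_[p])) 1 g.y) ∧
      -- the normalized matrix coefficients form an orthonormal basis of `𝒟_n(ℍ_d)`
      (∀ n : ℕ,
        (∀ i j : CoeffIdx p d n,
          ∫ g, normCoeff π n i g * (starRingEnd ℂ) (normCoeff π n j g) ∂(heisHaar p d) =
            open Classical in if i = j then 1 else 0) ∧
        Submodule.span ℂ (Set.range (normCoeff π n)) = smoothFun p d n) := by
  refine ⟨heisRep, isIrreducible_heisRep, actsByFormula_heisRep, ⟨fun t t' h => ?_, fun c => ?_⟩,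
    fun H _ _ _ ρ hρ => ?_, fun t => ⟨finrank_HLam t.lam_mem, orthonormal_phiH t.lam_mem,
      span_phiH t.lam⟩, matCoeff_heisRep_mk, repCharacter_heisRep,
    fun n => ⟨integral_normCoeff n, span_normCoeff n⟩⟩
  · exact heisParam_eq_of_equivalent (Quotient.exact h)
  · induction c using Quotient.inductionOn with
    | h ρ =>
      obtain ⟨t, U, hU⟩ := exists_equivalent_heisRep ρ.rep ρ.irreducible
      refine ⟨t, Quotient.sound ((instSetoidUnitaryIrrep _).symm ⟨U, hU⟩)⟩
  · obtain ⟨t, ht⟩ := exists_equivalent_heisRep ρ hρ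
    refine ⟨t, ht, fun t' ht' => heisParam_eq_of_equivalent ?_⟩
    obtain ⟨U, hU⟩ := ht
    obtain ⟨U', hU'⟩ := ht'
    refine ⟨U'.symm.trans U, fun g v => ?_⟩
    obtain ⟨w, rfl⟩ := U'.surjective v
    rw [← hU']
    simp [hU]
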